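/- Let $\mathfrak H$ be an infinite-dimensional separable complex Hilbert space. An operator $A$ in $\mathfrak H$ is accretive if $\operatorname{Re}(Au,u)\ge 0$ for all $u\in\operatorname{dom}A$, and $m$-accretive if moreover it is densely defined and $\operatorname{ran}(A-\lambda I)=\mathfrak H$ for some $\lambda$ with $\operatorname{Re}\lambda<0$; it is sectorial if its numerical range lies in a sector $\{|\arg z|\le\alpha\}$ for some $\alpha\in[0,\pi/2)$, and $m$-sectorial if it is both $m$-accretive and sectorial. For $m$-accretive $A$, $A^{1/2}$ denotes its unique $m$-accretive square root, and $A^{*1/2}:=(A^*)^{1/2}=(A^{1/2})^*$. For a bounded operator $T$, $\operatorname{Re}T=\frac12(T+T^*)$ and $\operatorname{Im}T=\frac1{2i}(T-T^*)$. Then there exists a family $\{\mathcal A(\xi)\}_{\xi\in\mathbb C}$ of unbounded, boundedly invertible, $m$-accretive and non-sectorial operators in $\mathfrak H$ that is norm-resolvent continuous (if $\lambda\in\rho(\mathcal A(\xi_0))$, then $\lambda\in\rho(\mathcal A(\xi))$ for $\xi$ near $\xi_0$, and $(\mathcal A(\xi)-\lambda I)^{-1}\to(\mathcal A(\xi_0)-\lambda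 I)^{-1}$ in operator norm as $\xi\to\xi_0$) and such that: - $\operatorname{dom}\mathcal A(\xi)\cap\operatorname{dom}\mathcal A(\xi)^*=\{0\}$ for each $\xi\in\mathbb C$; - $\operatorname{dom}\mathcal A(\xi)^{1/2}\ne\operatorname{dom}\mathcal A(\xi)^{*1/2}$ for each $\xi\in\mathbb C$; - the operator $\operatorname{Re}(\mathcal A(\xi)^{-1/2})$ does not depend on $\xi$; moreover each $\mathcal A(\xi)^{1/2}$ is $m$-sectorial, and the domain of the closed sesquilinear form associated with it does not depend on $\xi$; - $\operatorname{ran}\operatorname{Im}(\mathcal A(\xi)^{-1/2})$ is dense in $\mathfrak H$ for each $\xi$, and for $\zeta\neq\xi$ one has $\operatorname{ran}\operatorname{Im}(\mathcal A(\xi)^{-1/2})\cap\operatorname{ran}\operatorname{Im}(\mathcal A(\zeta)^{-1/2})=\{0\}$, while the direct sum $\operatorname{ran}\operatorname{Im}(\mathcal A(\xi)^{-1/2})\dotplus\operatorname{ran}\operatorname{Im}(\mathcal A(\zeta)^{-1/2})$ is one and the same linear manifold for all pairs $\xi\ne\zeta$; - for each $\xi\in\mathbb C$ the operator $F(\xi):=\mathcal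 A(\xi)^{1/2}\mathcal A(\xi)^{*-1/2}$ (on its natural domain) is $m$-accretive, $\operatorname{Re}(F(\xi)h,h)=0$ for all $h\in\operatorname{dom}F(\xi)$, and $\operatorname{dom}F(\xi)\subsetneq\operatorname{dom}F(\xi)^*$. -/

import Mathlib

open Filter Topology

noncomputable section

namespace KatoSqrt

variable {H : Type*} [NormedAddCommGroup H] [InnerProductSpace ℂ H]

/-- The numerical value `(A u, u)`, linear in `A u`; Mathlib's inner product is linear in its
second argument. -/
def quad (A : H →ₗ.[ℂ] H) (u : A.domain) : ℂ := inner ℂ (u : H) (A u)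

/-- `A` is accretive: `Re (A u, u) ≥ 0` on its domain. -/
def IsAccretive (A : H →ₗ.[ℂ] H) : Prop := ∀ u : A.domain, 0 ≤ (quad A u).re

/-- `A` is m-accretive: accretive, densely defined, and `ran (A - z) = H` for some `z` with
negative real part. -/
def IsMAccretive (A : H →ₗ.[ℂ] H) : Prop :=
  IsAccretive A ∧ Dense (A.domain : Set H) ∧
    ∃ z : ℂ, z.re < 0 ∧ ∀ x : H, ∃ u : A.domain, A u - z • (u : H) = x

/-- `A` is sectorial with vertex `0`: its numerical range lies in a closed sector
`{|arg z| ≤ α}` for some semi-angle `α ∈ [0, π/2)`. -/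
def IsSectorial (A : H →ₗ.[ℂ] H) : Prop :=
  ∃ α : ℝ, 0 ≤ α ∧ α < Real.pi / 2 ∧
    ∀ u : A.domain, 0 ≤ (quad A u).re ∧ |(quad A u).im| ≤ Real.tan α * (quad A u).re

/-- `A` is a bounded operator on its domain. -/
def IsBounded (A : H →ₗ.[ℂ] H) : Prop := ∃ C : ℝ, ∀ u : A.domain, ‖A u‖ ≤ C * ‖(u : H)‖

/-- The bounded, everywhere defined operator `R` is the resolvent `(A - z)⁻¹`. -/
def IsResolvent (A : H →ₗ.[ℂ] H) (z : ℂ) (R : H →L[ℂ] H) : Prop :=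
  ∀ x y : H, R x = y ↔ ∃ u : A.domain, (u : H) = y ∧ A u - z • (u : H) = x

/-- The resolvent set of `A`. -/
def resolventSet (A : H →ₗ.[ℂ] H) : Set ℂ := {z | ∃ R : H →L[ℂ] H, IsResolvent A z R}

/-- The bounded, everywhere defined operator `R` is the inverse `A⁻¹`. -/
def IsBoundedInverse (A : H →ₗ.[ℂ] H) (R : H →L[ℂ] H) : Prop := IsResolvent A 0 R

/-- Norm-resolvent continuity of a family of operators with nonempty resolvent sets: if `z` is in
the resolvent set of `A ξ₀`, then it is in that of `A ξ` for all `ξ` near `ξ₀`, and the resolvents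
at `z` converge in operator norm as `ξ → ξ₀`. -/
def NormResolventContinuous {X : Type*} [TopologicalSpace X] (A : X → (H →ₗ.[ℂ] H)) : Prop :=
  (∀ ξ, (resolventSet (A ξ)).Nonempty) ∧
    ∀ (ξ₀ : X) (z : ℂ) (R₀ : H →L[ℂ] H), IsResolvent (A ξ₀) z R₀ →
      ∀ ε : ℝ, 0 < ε → ∀ᶠ ξ in 𝓝 ξ₀, ∃ R : H →L[ℂ] H, IsResolvent (A ξ) z R ∧ ‖R - R₀‖ < ε

/-- The product `g f` of unbounded operators on its natural domain
`{x ∈ dom f : f x ∈ dom g}`. -/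
def opMul (g f : H →ₗ.[ℂ] H) : H →ₗ.[ℂ] H :=
  g.comp (f.domRestrict ((g.domain.comap f.toFun).map f.domain.subtype)) (by
    rintro ⟨x, hx⟩
    have hx2 := hx
    obtain ⟨⟨y, hy, hyx⟩, hxf⟩ := hx2
    have : f.domRestrict ((g.domain.comap f.toFun).map f.domain.subtype) ⟨x, hx⟩ = f y :=
      LinearPMap.domRestrict_apply hyx.symm
    rw [this]
    exact hy)

theorem mem_graph_opMul (g f : H →ₗ.[ℂ] H) (x z : H) :
    (x, z) ∈ (opMul g f).graph ↔ ∃ y, (x, y) ∈ f.graph ∧ (y, z) ∈ g.graph := by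
  constructor
  · intro h
    obtain ⟨⟨w, hw⟩, hwx, hwz⟩ := (LinearPMap.mem_graph_iff _).1 h
    have hw2 := hw
    obtain ⟨⟨y, hy, hyx⟩, hwf⟩ := hw2
    have e : f.domRestrict ((g.domain.comap f.toFun).map f.domain.subtype) ⟨w, hw⟩ = f y :=
      LinearPMap.domRestrict_apply hyx.symm
    refine ⟨f y, (LinearPMap.mem_graph_iff _).2 ⟨y, hyx.trans hwx, rfl⟩,
      (LinearPMap.mem_graph_iff _).2 ⟨⟨f y, hy⟩, rfl, ?_⟩⟩
    rw [← hwz]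
    change g _ = g _
    congr 1
    exact Subtype.ext e.symm
  · rintro ⟨y, h1, h2⟩
    obtain ⟨u, hu, hy⟩ := (LinearPMap.mem_graph_iff _).1 h1
    obtain ⟨v, hv, hz⟩ := (LinearPMap.mem_graph_iff _).1 h2
    simp only at hu hy hv hz
    have hm : f u ∈ g.domain := by rw [hy, ← hv]; exact v.2
    have hd : (u : H) ∈ (opMul g f).domain := ⟨⟨u, hm, rfl⟩, u.2⟩
    have e : f.domRestrict ((g.domain.comap f.toFun).map f.domain.subtype) ⟨u, hd⟩ = f u :=
      LinearPMap.domRestrict_apply rfl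
    refine (LinearPMap.mem_graph_iff _).2 ⟨⟨u, hd⟩, hu, ?_⟩
    rw [← hz]
    change g _ = g _
    congr 1
    exact Subtype.ext (e.trans (hy.trans hv.symm))

/-- `S` is the square root of the m-accretive operator `A`, that is, the (unique) m-accretive
operator with `S² = A`. -/
def IsMAccretiveSqrt (A S : H →ₗ.[ℂ] H) : Prop := IsMAccretive S ∧ opMul S S = A

/-- The range of the imaginary part `(T - T*) / (2i)` of a bounded operator. -/
def imRange [CompleteSpace H] (T : H →L[ℂ] H) : Submodule ℂ H :=
  LinearMap.range ((imaginaryPart T : H →L[ℂ] H) : H →ₗ[ℂ] H)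

variable (H) in
/-- A closed densely defined sectorial (with vertex `0`) sesquilinear form `a[u, v]`, linear in
`u` and conjugate-linear in `v`. -/
structure ClosedSectorialForm where
  domain : Submodule ℂ H
  form : domain →ₗ[ℂ] domain →ₗ⋆[ℂ] ℂ
  dense : Dense (domain : Set H)
  sectorial : ∃ α : ℝ, 0 ≤ α ∧ α < Real.pi / 2 ∧
    ∀ u, 0 ≤ (form u u).re ∧ |(form u u).im| ≤ Real.tan α * (form u u).re
  closed : ∀ (u : ℕ → domain) (x : H), Tendsto (fun n => (u n : H)) atTop (𝓝 x) →
    Tendsto (fun p : ℕ × ℕ => form (u p.1 - u p.2) (u p.1 - u p.2)) atTop (𝓝 0) →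
    ∃ y : domain, (y : H) = x ∧ Tendsto (fun n => form (u n - y) (u n - y)) atTop (𝓝 0)

/-- `A` is the m-sectorial operator associated with the closed form `a`:
`a[u, v] = (A u, v)` for all `u ∈ dom A ⊆ dom a` and `v ∈ dom a`. -/
def IsAssociated (a : ClosedSectorialForm H) (A : H →ₗ.[ℂ] H) : Prop :=
  IsMAccretive A ∧ IsSectorial A ∧
    ∀ u : A.domain, ∃ w : a.domain, (w : H) = u ∧
      ∀ v : a.domain, a.form w v = inner ℂ (v : H) (A u)

end KatoSqrt

end

open scoped InnerProduct

noncomputable section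

namespace KatoSqrt

variable {H : Type*} [NormedAddCommGroup H] [InnerProductSpace ℂ H]

/-! Everything is built from bounded inverses. For a pair as in `IsSymmetrizedIsometry` put `T = B +
iBK`, `S = T⁻¹` and `A = T⁻²`. Then `Re T = B` and `Im T = BK`, and self-adjointness of `BK` gives
`K*B = BK`. Hence `T = B(1 + iK) = (1 + iK*)B` and `T² = B(1 + iK)(1 + iK*)B`, whose real part is
`B(1 - KK*)B ≥ 0` and whose imaginary part is `B(K + K*)B`.

The pathologies come from `ran B ∩ ran K = {0}`, which makes `K` a non-surjective isometry. The real
part of `T²` degenerates in the limit along `ran K` while the imaginary part does not, so `A` is not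
sectorial; `dom A ∩ dom A* = {0}` reduces to `ran B ∩ ran K = {0}`; `dom S = B ran(1 + iK)` differs
from `dom S* = B ran(1 - iK)`; and `S S*⁻¹` is the Cayley transform `(1 - iK)(1 + iK)⁻¹` of the
non-unitary isometry `iK`. Since `0 ≤ BK ≤ B`, one has `T = B^{1/2}(1 + iX)B^{1/2}` with a positive
contraction `X`, so the form of `S` lives on `ran B^{1/2}`, whatever `K` is.

It remains to find one `B` serving a whole family `K ξ`. Let `J₁`, `J₂` be isometries with
orthogonal ranges and let `W ξ` be the normalized `J₁ + ξJ₂`. A polar decomposition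
(`exists_isSymmetrizedIsometry`) replaces `W ξ` by `K ξ` with the same range and `B K ξ = (B W ξ (W
ξ)* B)^{1/2}`, which is norm continuous in `ξ`. The ranges of `Im T` are then the images under `B`
of the graphs of multiplication by `ξ`, which meet only in `0` and span `B(ran J₁ + ran J₂)` in
pairs. The hypotheses on `B` follow from `exists_operator_with_independent_components`: `B = Z²`,
where the coordinates of `Zu` are weighted values of a power series at `2⁻ʲ`, and a linear
dependence between the even and the odd coordinates contradicts the leading-term asymptotics of the
series. -/

/-- The inverse of a bounded operator, as a partially defined operator. -/
def opInv (T : H →L[ℂ] H) : H →ₗ.[ℂ] H := ((T : H →ₗ[ℂ] H).toPMap ⊤).inverse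

/-! ### Inverses of injective bounded operators as unbounded operators -/

section opInv

variable {T : H →L[ℂ] H}

theorem mem_graph_toPMap_top (T : H →L[ℂ] H) {x y : H} :
    (x, y) ∈ ((T : H →ₗ[ℂ] H).toPMap ⊤).graph ↔ T x = y := by
  simp [LinearPMap.mem_graph_iff]

theorem mem_graph_opInv (hT : Function.Injective T) {x y : H} :
    (x, y) ∈ (opInv T).graph ↔ T y = x := by
  have hker : LinearMap.ker ((T : H →ₗ[ℂ] H).toPMap ⊤).toFun = ⊥ := by
    rw [LinearMap.ker_eq_bot]
    intro a b hab
    exact Subtype.ext (hT hab)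
  rw [opInv, LinearPMap.inverse_graph hker, Submodule.mem_map, ← mem_graph_toPMap_top T]
  constructor
  · rintro ⟨⟨a, b⟩, h, hab⟩
    simp only [LinearEquiv.coe_coe, LinearEquiv.prodComm_apply, Prod.swap_prod_mk,
      Prod.mk.injEq] at hab
    rwa [← hab.1, ← hab.2]
  · intro h
    exact ⟨(y, x), h, rfl⟩

theorem mem_domain_opInv (hT : Function.Injective T) {x : H} :
    x ∈ (opInv T).domain ↔ ∃ y, T y = x := by
  rw [LinearPMap.mem_domain_iff]
  simp_rw [mem_graph_opInv hT]

theorem apply_opInv (hT : Function.Injective T) (u : (opInv T).domain) :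
    T (opInv T u) = u :=
  (mem_graph_opInv hT).1 (LinearPMap.mem_graph _ u)

theorem exists_opInv_apply (hT : Function.Injective T) (y : H) :
    ∃ u : (opInv T).domain, (u : H) = T y ∧ opInv T u = y :=
  (LinearPMap.mem_graph_iff _).1 ((mem_graph_opInv hT).2 (rfl : T y = T y))

theorem dense_domain_opInv (hT : Function.Injective T) (hd : DenseRange T) :
    Dense ((opInv T).domain : Set H) := by
  refine hd.mono ?_
  rintro _ ⟨y, rfl⟩
  exact (mem_domain_opInv hT).2 ⟨y, rfl⟩

theorem opMul_opInv {T' : H →L[ℂ] H} (hT : Function.Injective T) (hT' : Function.Injective T') :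
    opMul (opInv T) (opInv T') = opInv (T' * T) := by
  have hc : Function.Injective (T' * T) := hT'.comp hT
  refine LinearPMap.eq_of_eq_graph ?_
  ext ⟨x, z⟩
  rw [mem_graph_opMul, mem_graph_opInv hc]
  simp_rw [mem_graph_opInv hT, mem_graph_opInv hT']
  exact ⟨fun ⟨y, h1, h2⟩ => by rw [← h1, ← h2]; rfl, fun h => ⟨T z, h, rfl⟩⟩

theorem mem_graph_inverse_opInv (hT : Function.Injective T) {x y : H} :
    (x, y) ∈ (opInv T).inverse.graph ↔ T x = y := by
  have hker : LinearMap.ker (opInv T).toFun = ⊥ := by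
    rw [LinearMap.ker_eq_bot']
    intro u hu
    apply Subtype.ext
    rw [← apply_opInv hT u]
    change T ((opInv T).toFun u) = 0
    rw [hu, map_zero]
  rw [LinearPMap.inverse_graph hker, Submodule.mem_map, ← mem_graph_opInv hT]
  constructor
  · rintro ⟨⟨a, b⟩, h, hab⟩
    simp only [LinearEquiv.coe_coe, LinearEquiv.prodComm_apply, Prod.swap_prod_mk,
      Prod.mk.injEq] at hab
    rwa [← hab.1, ← hab.2]
  · intro h
    exact ⟨(y, x), h, rfl⟩

theorem mem_graph_opMul_inverse {T' : H →L[ℂ] H} (hT : Function.Injective T)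
    (hT' : Function.Injective T') {x y : H} :
    (x, y) ∈ (opMul (opInv T) (opInv T').inverse).graph ↔ T' x = T y := by
  rw [mem_graph_opMul]
  simp_rw [mem_graph_inverse_opInv hT', mem_graph_opInv hT]
  exact ⟨fun ⟨z, h1, h2⟩ => h1.trans h2.symm, fun h => ⟨T' x, rfl, h.symm⟩⟩

theorem isResolvent_opInv (hT : Function.Injective T) {z : ℂ} {N : H →L[ℂ] H}
    (h1 : (1 - z • T) * N = 1) (h2 : N * (1 - z • T) = 1) :
    IsResolvent (opInv T) z (T * N) := by
  intro x y
  constructor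
  · intro h
    obtain ⟨u, hu, hy⟩ := exists_opInv_apply hT (N x)
    refine ⟨u, hu.trans h, ?_⟩
    rw [hu, hy]
    exact congrArg (fun M : H →L[ℂ] H => M x) h1
  · rintro ⟨u, rfl, rfl⟩
    have e := congrArg (fun M : H →L[ℂ] H => M (opInv T u)) h2
    simp only [mul_apply_eq_comp, sub_apply,
      one_apply_eq_self, smul_apply, apply_opInv hT] at e
    rw [mul_apply_eq_comp, e, apply_opInv hT]

theorem isBoundedInverse_opInv (hT : Function.Injective T) : IsBoundedInverse (opInv T) T := by
  have := isResolvent_opInv hT (z := 0) (N := 1) (by simp) (by simp)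
  simpa [IsBoundedInverse] using this

/-- A resolvent of `T⁻¹` at `z` makes `1 - z T` invertible. -/
theorem IsResolvent.isUnit_one_sub_smul (hT : Function.Injective T) {z : ℂ} {R : H →L[ℂ] H}
    (hR : IsResolvent (opInv T) z R) : R = T * Ring.inverse (1 - z • T) ∧ IsUnit (1 - z • T) := by
  have key : ∀ w, R (w - z • T w) = T w := by
    intro w
    obtain ⟨u, hu, hy⟩ := exists_opInv_apply hT w
    exact (hR _ _).2 ⟨u, hu, by rw [hy, hu]⟩
  have h1 : (1 - z • T) * (1 + z • R) = 1 := by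
    ext x
    obtain ⟨u, hu, hx⟩ := (hR x (R x)).1 rfl
    have e : opInv T u = x + z • R x := by
      rw [sub_eq_iff_eq_add.1 hx, hu]
    have e2 : T (x + z • R x) = R x := by rw [← e, apply_opInv hT, hu]
    simp only [mul_apply_eq_comp, sub_apply, add_apply,
      one_apply_eq_self, smul_apply]
    rw [e2, add_sub_cancel_right]
  have h2 : (1 + z • R) * (1 - z • T) = 1 := by
    ext x
    simp only [mul_apply_eq_comp, sub_apply, add_apply,
      one_apply_eq_self, smul_apply]
    rw [key]
    abel
  have hu : IsUnit (1 - z • T) := ⟨⟨_, _, h1, h2⟩, rfl⟩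
  refine ⟨?_, hu⟩
  have h3 : R * (1 - z • T) = T := by
    ext w
    exact key w
  calc R = R * ((1 - z • T) * Ring.inverse (1 - z • T)) := by
        rw [Ring.mul_inverse_cancel _ hu, mul_one]
    _ = T * Ring.inverse (1 - z • T) := by rw [← mul_assoc, h3]

/-- With `u = T x`, the value `(T⁻¹u, u)` is the complex conjugate of `(T x, x)`, and sectors are
symmetric about the real axis. -/
theorem isSectorial_opInv_iff (hT : Function.Injective T) :
    IsSectorial (opInv T) ↔ ∃ α : ℝ, 0 ≤ α ∧ α < Real.pi / 2 ∧ ∀ x, 0 ≤ (inner ℂ x (T x)).re ∧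
      |(inner ℂ x (T x)).im| ≤ Real.tan α * (inner ℂ x (T x)).re := by
  have e : ∀ u : (opInv T).domain, quad (opInv T) u =
      starRingEnd ℂ (inner ℂ (opInv T u) (T (opInv T u))) := by
    intro u
    rw [inner_conj_symm, apply_opInv hT, quad]
  refine exists_congr fun α => and_congr_right fun _ => and_congr_right fun _ => ?_
  constructor
  · intro h x
    obtain ⟨u, hu1, hu2⟩ := exists_opInv_apply hT x
    have := h u
    rwa [e, hu2, Complex.conj_re, Complex.conj_im, abs_neg] at this
  · intro h u
    rw [e, Complex.conj_re, Complex.conj_im, abs_neg]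
    exact h _

variable [CompleteSpace H]

/-- The resolvent at `z` is `T(1 - zT)⁻¹`; units form an open set and inversion is continuous there.
-/
theorem normResolventContinuous_opInv {X : Type*} [TopologicalSpace X] {L : X → (H →L[ℂ] H)}
    (hL : Continuous L) (hi : ∀ ξ, Function.Injective (L ξ)) :
    NormResolventContinuous (fun ξ => opInv (L ξ)) := by
  refine ⟨fun ξ => ⟨0, L ξ, isBoundedInverse_opInv (hi ξ)⟩, ?_⟩
  intro ξ₀ z R₀ hR ε hε
  obtain ⟨e, hu⟩ := hR.isUnit_one_sub_smul (hi ξ₀)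
  have hc : ContinuousAt (fun ξ => 1 - z • L ξ) ξ₀ := by fun_prop
  have hinv : ContinuousAt (fun ξ => L ξ * Ring.inverse (1 - z • L ξ)) ξ₀ := by
    refine hL.continuousAt.mul ?_
    obtain ⟨v, hv⟩ := hu
    have := NormedRing.inverse_continuousAt v
    rw [hv] at this
    exact ContinuousAt.comp (f := fun ξ => 1 - z • L ξ) this hc
  have h1 : ∀ᶠ ξ in 𝓝 ξ₀, IsUnit (1 - z • L ξ) := hc.eventually (Units.isOpen.mem_nhds hu)
  have h2 := hinv.eventually (Metric.ball_mem_nhds _ hε)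
  filter_upwards [h1, h2] with ξ hξ1 hξ2
  refine ⟨_, isResolvent_opInv (hi ξ) (Ring.mul_inverse_cancel _ hξ1)
    (Ring.inverse_mul_cancel _ hξ1), ?_⟩
  rw [e, ← dist_eq_norm]
  exact hξ2

theorem denseRange_of_injective_adjoint (h : Function.Injective (T†)) : DenseRange T := by
  have : (LinearMap.range (T : H →ₗ[ℂ] H)).topologicalClosure = ⊤ := by
    rw [Submodule.topologicalClosure_eq_top_iff, Submodule.eq_bot_iff]
    intro x hx
    apply h
    rw [map_zero]
    refine ext_inner_right ℂ fun y => ?_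
    rw [inner_zero_left]
    change inner ℂ ((T†) x) y = 0
    rw [ContinuousLinearMap.adjoint_inner_left]
    exact Submodule.inner_left_of_mem_orthogonal (LinearMap.mem_range_self _ y) hx
  exact Submodule.dense_iff_topologicalClosure_eq_top.2 this

theorem adjoint_opInv (hT : Function.Injective T) (hT' : Function.Injective (T†)) :
    (opInv T).adjoint = opInv (T†) := by
  refine LinearPMap.eq_of_eq_graph ?_
  rw [LinearPMap.adjoint_graph_eq_graph_adjoint
    (dense_domain_opInv hT (denseRange_of_injective_adjoint hT'))]
  ext ⟨x, y⟩
  rw [Submodule.mem_adjoint_iff, mem_graph_opInv hT']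
  constructor
  · intro h
    refine ext_inner_left ℂ fun z => ?_
    have := h (T z) z ((mem_graph_opInv hT).2 rfl)
    change inner ℂ z ((T†) y) = _
    rw [ContinuousLinearMap.adjoint_inner_right]
    exact (sub_eq_zero.1 this).symm
  · intro h a b hab
    rw [mem_graph_opInv hT] at hab
    rw [← hab, ← h]
    change inner ℂ b ((T†) y) - _ = 0
    rw [ContinuousLinearMap.adjoint_inner_right, sub_self]

theorem isMAccretive_opInv (hT : Function.Injective T) (hd : DenseRange T)
    (ha : ∀ x, 0 ≤ (inner ℂ x (T x)).re) : IsMAccretive (opInv T) := by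
  refine ⟨fun u => ?_, dense_domain_opInv hT hd, -1, by simp, fun x => ?_⟩
  · rw [quad, ← apply_opInv hT u, ← inner_conj_symm, Complex.conj_re]
    exact ha _
  · have hu : IsUnit (1 + T) := by
      refine ContinuousLinearMap.isUnit_of_forall_le_norm_inner_map _ (c := 1) one_pos fun y => ?_
      rw [← norm_inner_symm]
      refine le_trans ?_ ((Complex.abs_re_le_norm _).trans' (le_abs_self _))
      rw [add_apply, inner_add_right, Complex.add_re, one_apply_eq_self,
        inner_self_eq_norm_sq_to_K]
      have := ha y
      have e : (((‖y‖ : ℂ)) ^ 2).re = ‖y‖ ^ 2 := by norm_cast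
      simp only [Complex.coe_algebraMap, NNReal.coe_one, mul_one]
      rw [e]
      linarith
    obtain ⟨u, hu1, hu2⟩ := exists_opInv_apply hT (Ring.inverse (1 + T) x)
    refine ⟨u, ?_⟩
    rw [hu1, hu2]
    have := congrArg (fun M : H →L[ℂ] H => M x) (Ring.mul_inverse_cancel _ hu)
    simpa using this

theorem surjective_of_isBounded_opInv (hT : Function.Injective T) (hd : DenseRange T)
    (hb : IsBounded (opInv T)) : Function.Surjective T := by
  obtain ⟨C, hC⟩ := hb
  have h : ∀ y, ‖y‖ ≤ C * ‖T y‖ := fun y => by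
    obtain ⟨u, hu1, hu2⟩ := exists_opInv_apply hT y
    have := hC u
    rwa [hu1, hu2] at this
  have hanti : AntilipschitzWith (Real.toNNReal C) T :=
    T.antilipschitz_of_bound fun y => (h y).trans
      (mul_le_mul_of_nonneg_right (Real.le_coe_toNNReal C) (norm_nonneg _))
  have hcl : IsClosed (Set.range T) := hanti.isClosed_range T.uniformContinuous
  rw [← Set.range_eq_univ, ← hcl.closure_eq]
  exact hd.closure_range

end opInv

/-! ### Positive operators and their square roots -/

section Positive

variable {B : H →L[ℂ] H}

theorem re_inner_nonneg_of_nonneg (hB : 0 ≤ B) (x : H) : 0 ≤ (inner ℂ x (B x)).re :=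
  ((B.nonneg_iff_isPositive.1 hB).re_inner_nonneg_right x)

theorem im_inner_eq_zero_of_nonneg (hB : 0 ≤ B) (x : H) : (inner ℂ x (B x)).im = 0 :=
  (Complex.nonneg_iff.1 ((B.nonneg_iff_isPositive.1 hB).inner_nonneg_right x)).2.symm

variable [CompleteSpace H]

theorem adjoint_eq_of_nonneg (hB : 0 ≤ B) : B† = B :=
  (B.nonneg_iff_isPositive.1 hB).isSelfAdjoint.adjoint_eq

theorem sqrt_sqrt_apply (hB : 0 ≤ B) (x : H) : CFC.sqrt B (CFC.sqrt B x) = B x :=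
  congrArg (fun M : H →L[ℂ] H => M x) (CFC.sqrt_mul_sqrt_self B hB)

theorem re_inner_eq_norm_sqrt_sq (hB : 0 ≤ B) (x : H) :
    (inner ℂ x (B x)).re = ‖CFC.sqrt B x‖ ^ 2 := by
  rw [← sqrt_sqrt_apply hB x, ← ContinuousLinearMap.adjoint_inner_left,
    adjoint_eq_of_nonneg (CFC.sqrt_nonneg B), inner_self_eq_norm_sq_to_K]
  norm_cast

theorem apply_eq_zero_of_re_inner_eq_zero (hB : 0 ≤ B) {x : H} (h : (inner ℂ x (B x)).re = 0) :
    B x = 0 := by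
  rw [re_inner_eq_norm_sqrt_sq hB, sq_eq_zero_iff, norm_eq_zero] at h
  rw [← sqrt_sqrt_apply hB, h, map_zero]

theorem denseRange_of_adjoint_eq_of_injective (h : B† = B) (hi : Function.Injective B) :
    DenseRange B :=
  denseRange_of_injective_adjoint (by rwa [h])

end Positive

theorem adjoint_mul_self [CompleteSpace H] (T : H →L[ℂ] H) : (T * T)† = T† * T† :=
  star_mul _ _

/-! ### Isometries and their adjoints -/

section Isometry

variable [CompleteSpace H] {K : H →L[ℂ] H}

theorem adjoint_apply_apply_of_isometry (hK : ∀ x, ‖K x‖ = ‖x‖) (x : H) : (K†) (K x) = x :=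
  congrArg (fun M : H →L[ℂ] H => M x) (K.norm_map_iff_adjoint_comp_self.1 hK)

theorem norm_adjoint_apply_le_of_isometry (hK : ∀ x, ‖K x‖ = ‖x‖) (x : H) : ‖(K†) x‖ ≤ ‖x‖ := by
  refine ((K†).le_opNorm x).trans ?_
  rw [LinearIsometryEquiv.norm_map]
  exact mul_le_of_le_one_left (norm_nonneg _)
    (K.opNorm_le_bound zero_le_one fun y => by rw [hK, one_mul])

/-- A vector whose norm is preserved by `K*` lies in the range of the isometry `K`. -/
theorem apply_adjoint_apply_of_norm_le (hK : ∀ x, ‖K x‖ = ‖x‖) {x : H} (h : ‖x‖ ≤ ‖(K†) x‖) :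
    K ((K†) x) = x := by
  have h1 : inner ℂ (K ((K†) x)) x = ((‖(K†) x‖ : ℂ)) ^ 2 := by
    rw [← ContinuousLinearMap.adjoint_inner_right, inner_self_eq_norm_sq_to_K]
    rfl
  have h2 := @norm_sub_sq ℂ H _ _ _ (K ((K†) x)) x
  rw [h1, hK] at h2
  have h3 : RCLike.re ((‖(K†) x‖ : ℂ) ^ 2) = ‖(K†) x‖ ^ 2 := by
    change ((‖(K†) x‖ : ℂ) ^ 2).re = _
    norm_cast
  rw [h3] at h2
  have h4 : ‖x‖ ^ 2 ≤ ‖(K†) x‖ ^ 2 := pow_le_pow_left₀ (norm_nonneg _) h 2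
  have h5 : ‖K ((K†) x) - x‖ ^ 2 ≤ 0 := by linarith
  rw [← sub_eq_zero, ← norm_eq_zero]
  exact pow_eq_zero_iff two_ne_zero |>.1 (le_antisymm h5 (sq_nonneg _))

theorem apply_eq_inv_smul_of_adjoint_apply_eq_smul (hK : ∀ x, ‖K x‖ = ‖x‖) {c : ℂ} (hc : ‖c‖ = 1) {x : H}
    (h : (K†) x = c • x) : K x = (c⁻¹) • x := by
  have h1 := apply_adjoint_apply_of_norm_le hK (x := x) (by rw [h, norm_smul, hc, one_mul])
  have hc0 : c ≠ 0 := by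
    rintro rfl
    simp at hc
  rw [h, map_smul] at h1
  rw [eq_inv_smul_iff₀ hc0, h1]

/-- If `1 + cK` is bijective for an isometry `K` and `|c| = 1`, then `K` is surjective. -/
theorem surjective_of_bijective_one_add_smul (hK : ∀ x, ‖K x‖ = ‖x‖) {c : ℂ} (hc : ‖c‖ = 1)
    (h : Function.Bijective (1 + c • K : H →L[ℂ] H)) : Function.Surjective K := by
  have hu : IsUnit (1 + c • K) := ContinuousLinearMap.isUnit_iff_bijective.2 h
  have hc0 : c ≠ 0 := by
    rintro rfl
    simp at hc
  have hcc : c * starRingEnd ℂ c = 1 := by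
    rw [Complex.mul_conj, Complex.normSq_eq_norm_sq, hc]
    norm_num
  have hinj : Function.Injective (K†) := by
    rw [injective_iff_map_eq_zero]
    intro x hx
    obtain ⟨y, rfl⟩ := h.2 x
    -- From `K*K = 1` and `|c| = 1` follows `(1 + cK)* c = K*(1 + cK)`, so a kernel vector of `K*`
    -- yields one of the invertible `(1 + cK)*`.
    have h1 : star (1 + c • K) (c • y) = 0 := by
      rw [← hx]
      simp only [star_add, star_one, star_smul, add_apply, smul_apply, one_apply_eq_self, map_add,
        map_smul, adjoint_apply_apply_of_isometry hK, ContinuousLinearMap.star_eq_adjoint]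
      rw [smul_add, smul_smul, show star c = starRingEnd ℂ c from rfl, hcc, one_smul, add_comm]
    have h2 := (ContinuousLinearMap.isUnit_iff_bijective.1 hu.star).1
    have h3 := (injective_iff_map_eq_zero _).1 h2 _ h1
    rw [smul_eq_zero] at h3
    rw [h3.resolve_left hc0, map_zero]
  intro x
  exact ⟨(K†) x, hinj (adjoint_apply_apply_of_isometry hK _)⟩

end Isometry

/-! ### The operator `B + iBK` for a single isometry -/

/-- An injective positive operator `B` and an isometry `K` such that `B K` is positive and
dominated by `B`, and the ranges of `B` and `K` are disjoint. -/
structure IsSymmetrizedIsometry [CompleteSpace H] (B K : H →L[ℂ] H) : Prop where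
  nonneg : 0 ≤ B
  injective : Function.Injective B
  norm_apply : ∀ x, ‖K x‖ = ‖x‖
  mul_nonneg : 0 ≤ B * K
  mul_le : B * K ≤ B
  disjoint : ∀ x y, B x = K y → x = 0

/-- The operator `B + i B K`. -/
def rotated (B K : H →L[ℂ] H) : H →L[ℂ] H := B + Complex.I • (B * K)

theorem rotated_apply (B K : H →L[ℂ] H) (x : H) :
    rotated B K x = B (x + Complex.I • K x) := by
  simp [rotated]

theorem continuous_rotated {X : Type*} [TopologicalSpace X] {B : H →L[ℂ] H} {K : X → (H →L[ℂ] H)}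
    (h : Continuous fun ξ => B * K ξ) : Continuous fun ξ => rotated B (K ξ) := by
  unfold rotated
  fun_prop

namespace IsSymmetrizedIsometry

variable [CompleteSpace H] {B K : H →L[ℂ] H} (h : IsSymmetrizedIsometry B K)

include h

theorem adjoint_apply (x : H) : (K†) (B x) = B (K x) := by
  have := adjoint_eq_of_nonneg h.mul_nonneg
  rw [← ContinuousLinearMap.star_eq_adjoint, star_mul, ContinuousLinearMap.star_eq_adjoint,
    ContinuousLinearMap.star_eq_adjoint, adjoint_eq_of_nonneg h.nonneg] at this
  exact congrArg (fun M : H →L[ℂ] H => M x) this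

theorem adjoint_rotated : ((rotated B K)†) = B - Complex.I • (B * K) := by
  rw [← ContinuousLinearMap.star_eq_adjoint, rotated, star_add, star_smul,
    ContinuousLinearMap.star_eq_adjoint, ContinuousLinearMap.star_eq_adjoint,
    adjoint_eq_of_nonneg h.nonneg, adjoint_eq_of_nonneg h.mul_nonneg]
  simp [sub_eq_add_neg]

theorem adjoint_rotated_apply (x : H) : ((rotated B K)†) x = B (x - Complex.I • K x) := by
  rw [h.adjoint_rotated]
  simp

theorem realPart_rotated : (realPart (rotated B K) : H →L[ℂ] H) = B := by
  rw [realPart_apply_coe, ContinuousLinearMap.star_eq_adjoint, h.adjoint_rotated, rotated]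
  module

theorem imaginaryPart_rotated : (imaginaryPart (rotated B K) : H →L[ℂ] H) = B * K := by
  rw [imaginaryPart_apply_coe, ContinuousLinearMap.star_eq_adjoint, h.adjoint_rotated, rotated]
  have : B + Complex.I • (B * K) - (B - Complex.I • (B * K)) = (2 : ℝ) • Complex.I • (B * K) := by
    module
  rw [this, smul_smul (2 : ℝ)⁻¹, inv_mul_cancel₀ two_ne_zero, one_smul, smul_smul]
  simp

theorem re_inner_rotated (x : H) : (inner ℂ x (rotated B K x)).re = (inner ℂ x (B x)).re := by
  rw [rotated, add_apply, smul_apply, inner_add_right, inner_smul_right]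
  have := im_inner_eq_zero_of_nonneg h.mul_nonneg x
  rw [mul_apply_eq_comp] at this
  simp [this]

theorem im_inner_rotated (x : H) :
    (inner ℂ x (rotated B K x)).im = (inner ℂ x ((B * K) x)).re := by
  rw [rotated, add_apply, smul_apply, inner_add_right, inner_smul_right]
  simp [im_inner_eq_zero_of_nonneg h.nonneg x]

theorem re_inner_adjoint_rotated (x : H) :
    (inner ℂ x (((rotated B K)†) x)).re = (inner ℂ x (B x)).re := by
  rw [ContinuousLinearMap.adjoint_inner_right, ← h.re_inner_rotated, ← inner_conj_symm,
    Complex.conj_re]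

theorem rotated_injective : Function.Injective (rotated B K) := by
  rw [injective_iff_map_eq_zero]
  intro x hx
  refine (injective_iff_map_eq_zero B).1 h.injective x
    (apply_eq_zero_of_re_inner_eq_zero h.nonneg ?_)
  rw [← h.re_inner_rotated, hx, inner_zero_right, Complex.zero_re]

theorem adjoint_rotated_injective : Function.Injective ((rotated B K)†) := by
  rw [injective_iff_map_eq_zero]
  intro x hx
  refine (injective_iff_map_eq_zero B).1 h.injective x
    (apply_eq_zero_of_re_inner_eq_zero h.nonneg ?_)
  rw [← h.re_inner_adjoint_rotated, hx, inner_zero_right, Complex.zero_re]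

theorem rotated_denseRange : DenseRange (rotated B K) :=
  denseRange_of_injective_adjoint h.adjoint_rotated_injective

theorem adjoint_rotated_denseRange : DenseRange ((rotated B K)†) :=
  denseRange_of_injective_adjoint
    (by rw [ContinuousLinearMap.adjoint_adjoint]; exact h.rotated_injective)

/-- Because `T = B(1 + iK)` is injective, `i` is not an eigenvalue of `K`; the companion lemma for
`T*` excludes `-i`. -/
theorem eq_zero_of_add {x : H} (hx : x + Complex.I • K x = 0) : x = 0 :=
  (injective_iff_map_eq_zero _).1 h.rotated_injective x (by rw [rotated_apply, hx, map_zero])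

theorem eq_zero_of_sub {x : H} (hx : x - Complex.I • K x = 0) : x = 0 :=
  (injective_iff_map_eq_zero _).1 h.adjoint_rotated_injective x
    (by rw [h.adjoint_rotated_apply, hx, map_zero])

theorem isMAccretive_opInv_rotated : IsMAccretive (opInv (rotated B K)) :=
  isMAccretive_opInv h.rotated_injective h.rotated_denseRange fun x => by
    rw [h.re_inner_rotated]
    exact re_inner_nonneg_of_nonneg h.nonneg x

theorem isMAccretive_opInv_adjoint_rotated : IsMAccretive (opInv ((rotated B K)†)) :=
  isMAccretive_opInv h.adjoint_rotated_injective h.adjoint_rotated_denseRange fun x => by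
    rw [h.re_inner_adjoint_rotated]
    exact re_inner_nonneg_of_nonneg h.nonneg x

theorem isSectorial_opInv_rotated : IsSectorial (opInv (rotated B K)) := by
  refine (isSectorial_opInv_iff h.rotated_injective).2
    ⟨Real.pi / 4, by positivity, by linarith [Real.pi_pos], fun x => ?_⟩
  rw [h.re_inner_rotated, h.im_inner_rotated, Real.tan_pi_div_four, one_mul,
    abs_of_nonneg (re_inner_nonneg_of_nonneg h.mul_nonneg x)]
  refine ⟨re_inner_nonneg_of_nonneg h.nonneg x, ?_⟩
  have := re_inner_nonneg_of_nonneg (sub_nonneg.2 h.mul_le) x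
  rwa [sub_apply, inner_sub_right, Complex.sub_re, sub_nonneg] at this

/-- The square of `B + i B K` is `(1 + i K*) B² (1 + i K)`. -/
theorem rotated_rotated (x : H) :
    rotated B K (rotated B K x) = B (B x + Complex.I • K (B x) + Complex.I • (K†) (B x) -
      K ((K†) (B x))) := by
  rw [rotated_apply, rotated_apply, map_add B x, map_smul B, ← h.adjoint_apply]
  simp only [map_add, map_sub, map_smul, smul_add, smul_smul, Complex.I_mul_I]
  module

theorem adjoint_rotated_adjoint_rotated (x : H) :
    ((rotated B K)†) (((rotated B K)†) x) = B (B x - Complex.I • K (B x) - Complex.I • (K†) (B x) -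
      K ((K†) (B x))) := by
  rw [h.adjoint_rotated_apply, h.adjoint_rotated_apply, map_sub B x, map_smul B,
    ← h.adjoint_apply]
  simp only [map_sub, map_smul, smul_sub, smul_smul, Complex.I_mul_I]
  module

/-- Expanding `B(1 + iK)(1 + iK*)B` separates the form of `B(1 - KK*)B` from that of `B(K + K*)B`.
-/
theorem inner_rotated_rotated (x : H) :
    inner ℂ x (rotated B K (rotated B K x)) = ((‖B x‖ ^ 2 - ‖(K†) (B x)‖ ^ 2 : ℝ) : ℂ) +
      Complex.I * ((2 * (inner ℂ (B x) (K (B x))).re : ℝ) : ℂ) := by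
  have e1 : ∀ y, inner ℂ x (B y) = inner ℂ (B x) y := fun y => by
    rw [← ContinuousLinearMap.adjoint_inner_left, adjoint_eq_of_nonneg h.nonneg]
  have e2 : inner ℂ (B x) ((K†) (B x)) = starRingEnd ℂ (inner ℂ (B x) (K (B x))) := by
    rw [ContinuousLinearMap.adjoint_inner_right, inner_conj_symm]
  have e3 : inner ℂ (B x) (K ((K†) (B x))) = ((‖(K†) (B x)‖ : ℂ)) ^ 2 := by
    rw [← ContinuousLinearMap.adjoint_inner_left, inner_self_eq_norm_sq_to_K]
    rfl
  rw [h.rotated_rotated, e1, inner_sub_right, inner_add_right, inner_add_right, inner_smul_right,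
    inner_smul_right, e2, e3, inner_self_eq_norm_sq_to_K, ← Complex.add_conj]
  push_cast
  simp only [Complex.coe_algebraMap]
  ring

theorem re_inner_rotated_rotated (x : H) :
    (inner ℂ x (rotated B K (rotated B K x))).re = ‖B x‖ ^ 2 - ‖(K†) (B x)‖ ^ 2 := by
  rw [h.inner_rotated_rotated, Complex.add_re, Complex.ofReal_re, Complex.I_mul_re,
    Complex.ofReal_im, neg_zero, add_zero]

theorem im_inner_rotated_rotated (x : H) :
    (inner ℂ x (rotated B K (rotated B K x))).im = 2 * (inner ℂ (B x) (K (B x))).re := by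
  rw [h.inner_rotated_rotated, Complex.add_im, Complex.ofReal_im, Complex.I_mul_im,
    Complex.ofReal_re, zero_add]

theorem sq_injective : Function.Injective (rotated B K * rotated B K) :=
  h.rotated_injective.comp h.rotated_injective

theorem adjoint_sq_injective : Function.Injective ((rotated B K * rotated B K)†) := by
  rw [adjoint_mul_self]
  exact h.adjoint_rotated_injective.comp h.adjoint_rotated_injective

theorem sq_denseRange : DenseRange (rotated B K * rotated B K) :=
  denseRange_of_injective_adjoint h.adjoint_sq_injective

theorem isMAccretive_opInv_sq : IsMAccretive (opInv (rotated B K * rotated B K)) := by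
  refine isMAccretive_opInv h.sq_injective h.sq_denseRange fun x => ?_
  rw [mul_apply_eq_comp, h.re_inner_rotated_rotated, sub_nonneg]
  exact pow_le_pow_left₀ (norm_nonneg _) (norm_adjoint_apply_le_of_isometry h.norm_apply _) 2

theorem isMAccretiveSqrt :
    IsMAccretiveSqrt (opInv (rotated B K * rotated B K)) (opInv (rotated B K)) :=
  ⟨h.isMAccretive_opInv_rotated, opMul_opInv h.rotated_injective h.rotated_injective⟩

theorem isMAccretiveSqrt_adjoint :
    IsMAccretiveSqrt (opInv (rotated B K * rotated B K)).adjoint (opInv (rotated B K)).adjoint := by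
  rw [adjoint_opInv h.sq_injective h.adjoint_sq_injective,
    adjoint_opInv h.rotated_injective h.adjoint_rotated_injective, adjoint_mul_self]
  exact ⟨h.isMAccretive_opInv_adjoint_rotated,
    opMul_opInv h.adjoint_rotated_injective h.adjoint_rotated_injective⟩

theorem dense_imRange : Dense (imRange (rotated B K) : Set H) := by
  rw [imRange, h.imaginaryPart_rotated]
  refine denseRange_of_adjoint_eq_of_injective (adjoint_eq_of_nonneg h.mul_nonneg) ?_
  rw [injective_iff_map_eq_zero]
  intro x hx
  have : K x = 0 := (injective_iff_map_eq_zero B).1 h.injective _ hx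
  rw [← norm_eq_zero, ← h.norm_apply, this, norm_zero]

theorem domain_inf_domain_adjoint :
    (opInv (rotated B K * rotated B K)).domain ⊓
      (opInv (rotated B K * rotated B K)).adjoint.domain = ⊥ := by
  rw [adjoint_opInv h.sq_injective h.adjoint_sq_injective, eq_bot_iff]
  rintro w ⟨hw1, hw2⟩
  obtain ⟨u, hu⟩ := (mem_domain_opInv h.sq_injective).1 hw1
  obtain ⟨v, hv⟩ := (mem_domain_opInv h.adjoint_sq_injective).1 hw2
  rw [mul_apply_eq_comp, h.rotated_rotated] at hu
  rw [adjoint_mul_self, mul_apply_eq_comp, h.adjoint_rotated_adjoint_rotated] at hv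
  have e := h.injective (hu.trans hv.symm)
  have hK := adjoint_apply_apply_of_isometry h.norm_apply
  -- Applying `K*` to `e` cancels the zeroth-order terms against those with `KK*` and leaves `(K*² +
  -- 1)(Bu + Bv) = 0`.
  have e1 : (K†) ((K†) (B u + B v)) = -(B u + B v) := by
    have := congrArg (fun y => (K†) y) e
    simp only [map_add, map_sub, map_smul, hK] at this
    have h3 : Complex.I • ((K†) ((K†) (B u + B v)) + (B u + B v)) = 0 := by
      simp only [map_add]
      linear_combination (norm := module) this
    rw [smul_eq_zero_iff_right Complex.I_ne_zero] at h3
    exact eq_neg_of_add_eq_zero_left h3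
  have hz : B u + B v = 0 := by
    generalize B u + B v = z at e1
    -- As `K*` is a contraction, `K*²z = -z` forces it to preserve the norms of `z` and `K*z`. Both
    -- lie in `ran K`, so `K²z = -z`, that is `(1 + iK)(1 - iK)z = 0`.
    have n1 : ‖z‖ ≤ ‖(K†) z‖ := by
      rw [← norm_neg, ← e1]
      exact norm_adjoint_apply_le_of_isometry h.norm_apply _
    have n2 : ‖(K†) z‖ ≤ ‖(K†) ((K†) z)‖ := by
      rw [e1, norm_neg]
      exact norm_adjoint_apply_le_of_isometry h.norm_apply _
    have e2 := apply_adjoint_apply_of_norm_le h.norm_apply n1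
    have e3 := apply_adjoint_apply_of_norm_le h.norm_apply n2
    rw [e1, map_neg] at e3
    have e4 : K (K z) = -z := by
      rw [← neg_eq_iff_eq_neg, ← map_neg, e3, e2]
    refine h.eq_zero_of_sub (h.eq_zero_of_add ?_)
    simp only [map_sub, map_smul, smul_sub, smul_smul, Complex.I_mul_I, e4]
    module
  have hv' : B v = -B u := eq_neg_of_add_eq_zero_right hz
  rw [hv'] at e
  -- With `Bv = -Bu` the first-order terms in `e` agree on both sides; what is left puts `Bu` into
  -- `ran K`.
  have e5 : B u = K ((K†) (B u)) := by
    simp only [map_neg, smul_neg] at e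
    have h3 : (2 : ℂ) • (B u - K ((K†) (B u))) = 0 := by
      linear_combination (norm := module) e
    rw [smul_eq_zero_iff_right two_ne_zero] at h3
    exact sub_eq_zero.1 h3
  have hu0 := h.disjoint _ _ e5
  rw [hu0] at hu
  simpa using hu.symm

variable [Nontrivial H]

theorem not_surjective : ¬ Function.Surjective K := by
  intro hs
  obtain ⟨x, hx⟩ := exists_ne (0 : H)
  obtain ⟨y, hy⟩ := hs (B x)
  exact hx (h.disjoint x y hy.symm)

theorem domain_ne_domain_adjoint :
    (opInv (rotated B K)).domain ≠ (opInv (rotated B K)).adjoint.domain := by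
  rw [adjoint_opInv h.rotated_injective h.adjoint_rotated_injective]
  intro he
  apply h.not_surjective
  -- Equality of the domains solves `(1 + iK)y = (1 - iK)(x/2)`, and adding `(1 + iK)(x/2)` gives
  -- `(1 + iK)(y + x/2) = x`.
  refine surjective_of_bijective_one_add_smul h.norm_apply (c := Complex.I) (by simp) ⟨?_, ?_⟩
  · rw [injective_iff_map_eq_zero]
    intro x hx
    exact h.eq_zero_of_add hx
  · intro x
    have h1 : ((rotated B K)†) ((2 : ℂ)⁻¹ • x) ∈ (opInv (rotated B K)).domain := by
      rw [he]
      exact (mem_domain_opInv h.adjoint_rotated_injective).2 ⟨_, rfl⟩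
    obtain ⟨y, hy⟩ := (mem_domain_opInv h.rotated_injective).1 h1
    rw [rotated_apply, h.adjoint_rotated_apply] at hy
    have h2 := h.injective hy
    refine ⟨y + (2 : ℂ)⁻¹ • x, ?_⟩
    simp only [add_apply, one_apply_eq_self, smul_apply, map_add, map_smul] at h2 ⊢
    linear_combination (norm := module) h2

theorem not_isSectorial_opInv_sq : ¬ IsSectorial (opInv (rotated B K * rotated B K)) := by
  rw [isSectorial_opInv_iff h.sq_injective]
  rintro ⟨α, -, -, hα⟩
  have hd := denseRange_of_adjoint_eq_of_injective (adjoint_eq_of_nonneg h.nonneg) h.injective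
  -- The sector inequality holds on the dense range of `B`, hence everywhere by continuity. On `ran
  -- K` its right side vanishes, so `Re (Ky, y) = 0` for all `y`.
  have key : ∀ y, |2 * (inner ℂ y (K y)).re| ≤ Real.tan α * (‖y‖ ^ 2 - ‖(K†) y‖ ^ 2) := by
    intro y
    refine hd.induction_on (p := fun y => |2 * (inner ℂ y (K y)).re| ≤
      Real.tan α * (‖y‖ ^ 2 - ‖(K†) y‖ ^ 2)) y (isClosed_le ?_ ?_) fun x => ?_
    · exact ((continuous_const.mul (Complex.continuous_re.comp
        (continuous_id.inner K.continuous))).abs)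
    · fun_prop
    · have := (hα x).2
      rwa [mul_apply_eq_comp, h.re_inner_rotated_rotated, h.im_inner_rotated_rotated] at this
  have h0 : ∀ y, (inner ℂ y (K y)).re = 0 := by
    intro y
    have := key (K y)
    rw [adjoint_apply_apply_of_isometry h.norm_apply, h.norm_apply, sub_self, mul_zero,
      abs_nonpos_iff, ← ContinuousLinearMap.adjoint_inner_left,
      adjoint_apply_apply_of_isometry h.norm_apply] at this
    linarith
  apply h.not_surjective
  intro y
  refine ⟨(K†) y, apply_adjoint_apply_of_norm_le h.norm_apply ?_⟩
  -- polarization gives `K* = -K`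
  have hpol : ∀ y z, (inner ℂ ((K†) y) z).re = -(inner ℂ (K y) z).re := by
    intro y z
    have := h0 (y + z)
    rw [map_add, inner_add_left, inner_add_right, inner_add_right, Complex.add_re, Complex.add_re,
      Complex.add_re, h0, h0, ← inner_conj_symm z (K y), Complex.conj_re] at this
    rw [ContinuousLinearMap.adjoint_inner_left]
    linarith
  have e : (K†) y = -K y := by
    rw [← add_eq_zero_iff_eq_neg, ← norm_eq_zero, ← sq_eq_zero_iff]
    have := hpol y ((K†) y + K y)
    have e2 := @inner_self_eq_norm_sq ℂ H _ _ _ ((K†) y + K y)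
    rw [← e2, inner_add_left, map_add]
    change (_ : ℂ).re + (_ : ℂ).re = 0
    linarith
  rw [e, norm_neg, h.norm_apply]

/-- Boundedness would make `T²` surjective, so `ran B` would be the whole space and meet `ran K`
nontrivially. -/
theorem not_isBounded_opInv_sq : ¬ IsBounded (opInv (rotated B K * rotated B K)) := by
  intro hb
  have hs := surjective_of_isBounded_opInv h.sq_injective h.sq_denseRange hb
  obtain ⟨x, hx⟩ := exists_ne (0 : H)
  obtain ⟨y, hy⟩ := hs (K x)
  rw [mul_apply_eq_comp, rotated_apply] at hy
  have h1 := h.disjoint _ _ hy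
  have h2 := (injective_iff_map_eq_zero _).1 h.rotated_injective _ (h.eq_zero_of_add h1)
  rw [h2] at hy
  simp only [map_zero, smul_zero, add_zero] at hy
  exact hx (by rw [← norm_eq_zero, ← h.norm_apply, ← hy, norm_zero])

end IsSymmetrizedIsometry

/-! ### The operator `S S*⁻¹` as a Cayley transform -/

namespace IsSymmetrizedIsometry

variable [CompleteSpace H] {B K : H →L[ℂ] H} (h : IsSymmetrizedIsometry B K)

include h

/-- The relation `T*x = Ty` reads `x - y = iK(x + y)` after cancelling `B`; the parameter is `f = (x
+ y)/2`. -/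
theorem mem_graph_opMul_adjoint_inverse {x y : H} :
    (x, y) ∈ (opMul (opInv (rotated B K)) (opInv (rotated B K)).adjoint.inverse).graph ↔
      ∃ f, x = f + Complex.I • K f ∧ y = f - Complex.I • K f := by
  rw [adjoint_opInv h.rotated_injective h.adjoint_rotated_injective,
    mem_graph_opMul_inverse h.rotated_injective h.adjoint_rotated_injective, rotated_apply,
    h.adjoint_rotated_apply, h.injective.eq_iff]
  constructor
  · intro e
    refine ⟨(2 : ℂ)⁻¹ • (x + y), ?_, ?_⟩
    · simp only [map_smul, map_add]
      linear_combination (norm := module) (2 : ℂ)⁻¹ • e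
    · simp only [map_smul, map_add]
      linear_combination (norm := module) -(2 : ℂ)⁻¹ • e
  · rintro ⟨f, rfl, rfl⟩
    simp only [map_add, map_sub, map_smul]
    module

theorem dense_domain_opMul_adjoint_inverse :
    Dense ((opMul (opInv (rotated B K)) (opInv (rotated B K)).adjoint.inverse).domain :
      Set H) := by
  have hd : DenseRange (1 + Complex.I • K : H →L[ℂ] H) := by
    refine denseRange_of_injective_adjoint ((injective_iff_map_eq_zero _).2 fun x hx => ?_)
    rw [← ContinuousLinearMap.star_eq_adjoint, star_add, star_one, star_smul,
      ContinuousLinearMap.star_eq_adjoint] at hx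
    simp only [RCLike.star_def, Complex.conj_I, neg_smul, add_apply, one_apply_eq_self, neg_apply,
      smul_apply] at hx
    -- A vector orthogonal to `ran(1 + iK)` is an eigenvector of `K*` of unimodular eigenvalue,
    -- hence one of `K` with eigenvalue `i`, which is excluded.
    have h1 : (K†) x = (-Complex.I) • x := by
      have h2 : Complex.I • (K†) x = x := (sub_eq_zero.1 ((sub_eq_add_neg _ _).trans hx)).symm
      rw [← h2, smul_smul, neg_mul, Complex.I_mul_I, neg_neg, one_smul, h2]
    have h3 := apply_eq_inv_smul_of_adjoint_apply_eq_smul h.norm_apply (by simp) h1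
    apply h.eq_zero_of_add
    rw [h3, smul_smul, inv_neg, Complex.inv_I, neg_neg, Complex.I_mul_I]
    module
  refine hd.mono ?_
  rintro _ ⟨f, rfl⟩
  exact LinearPMap.mem_domain_iff.2 ⟨_, h.mem_graph_opMul_adjoint_inverse.2 ⟨f, rfl, rfl⟩⟩

theorem re_quad_opMul_adjoint_inverse
    (u : (opMul (opInv (rotated B K)) (opInv (rotated B K)).adjoint.inverse).domain) :
    (quad (opMul (opInv (rotated B K)) (opInv (rotated B K)).adjoint.inverse) u).re = 0 := by
  obtain ⟨f, h1, h2⟩ := h.mem_graph_opMul_adjoint_inverse.1 (LinearPMap.mem_graph _ u)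
  rw [quad, h1, h2]
  have e : ‖Complex.I • K f‖ = ‖f‖ := by rw [norm_smul, Complex.norm_I, one_mul, h.norm_apply]
  generalize Complex.I • K f = g at e
  rw [inner_add_left, inner_sub_right, inner_sub_right, inner_self_eq_norm_sq_to_K,
    inner_self_eq_norm_sq_to_K, e, ← inner_conj_symm f g]
  simp only [Complex.add_re, Complex.sub_re, Complex.conj_re]
  ring

theorem isMAccretive_opMul_adjoint_inverse :
    IsMAccretive (opMul (opInv (rotated B K)) (opInv (rotated B K)).adjoint.inverse) := by
  refine ⟨fun u => (h.re_quad_opMul_adjoint_inverse u).ge, h.dense_domain_opMul_adjoint_inverse,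
    -1, by simp, fun x => ?_⟩
  -- On the graph, `Fu + u = 2f`, so `f = x/2` solves the equation.
  obtain ⟨u, h1, h2⟩ := (LinearPMap.mem_graph_iff _).1
    (h.mem_graph_opMul_adjoint_inverse.2 ⟨(2 : ℂ)⁻¹ • x, rfl, rfl⟩)
  refine ⟨u, ?_⟩
  rw [h1, h2]
  module

/-- Isometry of `iK` gives `-F ⊆ F*`. Equality of the domains would make `F* = -F`, but `F*x = x`
for every `x` in `ker K*`; on the graph of `-F` this forces `f = 0`, so `K*` would be injective and
`K` onto. -/
theorem domain_opMul_adjoint_inverse_lt [Nontrivial H] :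
    (opMul (opInv (rotated B K)) (opInv (rotated B K)).adjoint.inverse).domain <
      (opMul (opInv (rotated B K)) (opInv (rotated B K)).adjoint.inverse).adjoint.domain := by
  have hg := LinearPMap.adjoint_graph_eq_graph_adjoint h.dense_domain_opMul_adjoint_inverse
  have hmem : ∀ x y, (x, y) ∈ (opMul (opInv (rotated B K))
      (opInv (rotated B K)).adjoint.inverse).adjoint.graph ↔
      ∀ f, inner ℂ (f - Complex.I • K f) x = inner ℂ (f + Complex.I • K f) y := by
    intro x y
    rw [hg, Submodule.mem_adjoint_iff]
    constructor
    · intro hxy f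
      exact sub_eq_zero.1 (hxy _ _ (h.mem_graph_opMul_adjoint_inverse.2 ⟨f, rfl, rfl⟩))
    · intro hxy a b hab
      obtain ⟨f, rfl, rfl⟩ := h.mem_graph_opMul_adjoint_inverse.1 hab
      exact sub_eq_zero.2 (hxy f)
  have hskew : ∀ g, (g + Complex.I • K g, -(g - Complex.I • K g)) ∈ (opMul (opInv (rotated B K))
      (opInv (rotated B K)).adjoint.inverse).adjoint.graph := by
    intro g
    rw [hmem]
    intro f
    have e : inner ℂ (Complex.I • K f) (Complex.I • K g) = inner ℂ f g := by
      rw [inner_smul_left, inner_smul_right, ← mul_assoc, Complex.conj_I, neg_mul, Complex.I_mul_I,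
        neg_neg, one_mul, ← ContinuousLinearMap.adjoint_inner_left,
        adjoint_apply_apply_of_isometry h.norm_apply]
    rw [inner_neg_right, inner_sub_right, inner_add_right, inner_sub_left, inner_sub_left,
      inner_add_left, inner_add_left, e]
    ring
  refine lt_of_le_of_ne (fun x hx => ?_) fun heq => h.not_surjective ?_
  · obtain ⟨y, hy⟩ := LinearPMap.mem_domain_iff.1 hx
    obtain ⟨g, rfl, -⟩ := h.mem_graph_opMul_adjoint_inverse.1 hy
    exact LinearPMap.mem_domain_iff.2 ⟨_, hskew g⟩
  · -- a vector orthogonal to the range of `K` lies in the domain of the adjoint only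
    have hker : Function.Injective (K†) := by
      rw [injective_iff_map_eq_zero]
      intro x hx
      have hxx : (x, x) ∈ (opMul (opInv (rotated B K))
          (opInv (rotated B K)).adjoint.inverse).adjoint.graph := by
        rw [hmem]
        intro f
        have e : inner ℂ (Complex.I • K f) x = 0 := by
          rw [inner_smul_left, ← ContinuousLinearMap.adjoint_inner_right, hx, inner_zero_right,
            mul_zero]
        rw [inner_sub_left, inner_add_left, e, sub_zero, add_zero]
      have hd := LinearPMap.mem_domain_iff.2 ⟨_, hxx⟩
      rw [← heq] at hd
      obtain ⟨y, hy⟩ := LinearPMap.mem_domain_iff.1 hd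
      obtain ⟨g, hg1, -⟩ := h.mem_graph_opMul_adjoint_inverse.1 hy
      have h1 := hskew g
      rw [← hg1] at h1
      have h2 := LinearPMap.mem_graph_snd_inj _ hxx h1 rfl
      have h3 : (2 : ℂ) • g = 0 := by
        linear_combination (norm := module) h2 - hg1
      rw [smul_eq_zero_iff_right two_ne_zero] at h3
      rw [hg1, h3, map_zero, smul_zero, add_zero]
    intro x
    exact ⟨(K†) x, hker (adjoint_apply_apply_of_isometry h.norm_apply _)⟩

end IsSymmetrizedIsometry

/-! ### The closed form associated with `S` -/

section Form

/-- The sesquilinear form `(N G⁻¹ u, G⁻¹ v)` on the range of `G`. -/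
def rangeForm (G N : H →L[ℂ] H) (hG : Function.Injective G) :
    LinearMap.range (G : H →ₗ[ℂ] H) →ₗ[ℂ] LinearMap.range (G : H →ₗ[ℂ] H) →ₗ⋆[ℂ] ℂ :=
  ((innerₛₗ ℂ).flip.comp
      ((N : H →ₗ[ℂ] H).comp (LinearEquiv.ofInjective (G : H →ₗ[ℂ] H) hG).symm.toLinearMap)).compl₂
    (LinearEquiv.ofInjective (G : H →ₗ[ℂ] H) hG).symm.toLinearMap

theorem rangeForm_apply {G N : H →L[ℂ] H} (hG : Function.Injective G) {u v : H}
    {u' v' : LinearMap.range (G : H →ₗ[ℂ] H)} (hu : (u' : H) = G u) (hv : (v' : H) = G v) :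
    rangeForm G N hG u' v' = inner ℂ v (N u) := by
  have key : ∀ (w : H) (w' : LinearMap.range (G : H →ₗ[ℂ] H)), (w' : H) = G w →
      (LinearEquiv.ofInjective (G : H →ₗ[ℂ] H) hG).symm w' = w := by
    intro w w' hw
    rw [LinearEquiv.symm_apply_eq]
    exact Subtype.ext hw
  simp [rangeForm, key u u' hu, key v v' hv]

variable [CompleteSpace H]

theorem sqrt_injective {B : H →L[ℂ] H} (hB : 0 ≤ B) (hi : Function.Injective B) :
    Function.Injective (CFC.sqrt B : H →L[ℂ] H) := by
  rw [injective_iff_map_eq_zero]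
  intro x hx
  refine (injective_iff_map_eq_zero B).1 hi x ?_
  rw [← sqrt_sqrt_apply hB, hx, map_zero]

/-- An operator `0 ≤ C ≤ B` factors as `C = B^{1/2} X B^{1/2}` with a positive contraction `X`. -/
theorem exists_eq_sqrt_mul_mul_sqrt {B C : H →L[ℂ] H} (hB : 0 ≤ B) (hi : Function.Injective B)
    (hC : 0 ≤ C) (hCB : C ≤ B) :
    ∃ X : H →L[ℂ] H, 0 ≤ X ∧ ‖X‖ ≤ 1 ∧ C = CFC.sqrt B * X * CFC.sqrt B := by
  set G := CFC.sqrt B with hG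
  have hGa : G† = G := adjoint_eq_of_nonneg (CFC.sqrt_nonneg B)
  have hGi : Function.Injective G := sqrt_injective hB hi
  have hGd := denseRange_of_adjoint_eq_of_injective hGa hGi
  have hle : ∀ x, ‖CFC.sqrt C x‖ ≤ 1 * ‖G x‖ := by
    intro x
    rw [one_mul]
    refine le_of_sq_le_sq ?_ (norm_nonneg _)
    rw [← re_inner_eq_norm_sqrt_sq hC, ← re_inner_eq_norm_sqrt_sq hB]
    have := re_inner_nonneg_of_nonneg (sub_nonneg.2 hCB) x
    rwa [sub_apply, inner_sub_right, Complex.sub_re, sub_nonneg] at this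
  -- `Y` is the continuous extension of `C^{1/2}B^{-1/2}`, a contraction because `C ≤ B`; then `X =
  -- Y*Y`.
  set Y : H →L[ℂ] H := ((CFC.sqrt C : H →L[ℂ] H) : H →ₗ[ℂ] H).extendOfNorm (G : H →ₗ[ℂ] H) with hY
  have hYG : Y * G = CFC.sqrt C := by
    ext x
    exact LinearMap.extendOfNorm_eq hGd ⟨1, hle⟩ x
  have hYn : ‖Y‖ ≤ 1 := LinearMap.opNorm_extendOfNorm_le hGd zero_le_one hle
  refine ⟨star Y * Y, star_mul_self_nonneg Y, ?_, ?_⟩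
  · rw [CStarRing.norm_star_mul_self]
    exact mul_le_one₀ hYn (norm_nonneg _) hYn
  · calc C = star (CFC.sqrt C) * CFC.sqrt C := by
          rw [ContinuousLinearMap.star_eq_adjoint, adjoint_eq_of_nonneg (CFC.sqrt_nonneg C),
            CFC.sqrt_mul_sqrt_self C hC]
      _ = G * (star Y * Y) * G := by
          rw [← hYG, star_mul, ContinuousLinearMap.star_eq_adjoint, hGa]
          simp only [mul_assoc]

theorem isUnit_one_add_I_smul {X : H →L[ℂ] H} (hX : 0 ≤ X) : IsUnit (1 + Complex.I • X) := by
  refine ContinuousLinearMap.isUnit_of_forall_le_norm_inner_map _ (c := 1) one_pos fun y => ?_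
  rw [norm_inner_symm]
  refine le_trans ?_ ((Complex.abs_re_le_norm _).trans' (le_abs_self _))
  rw [add_apply, inner_add_right, Complex.add_re, one_apply_eq_self, smul_apply, inner_smul_right,
    Complex.I_mul_re, im_inner_eq_zero_of_nonneg hX, neg_zero, add_zero, NNReal.coe_one, mul_one]
  exact (@inner_self_eq_norm_sq ℂ H _ _ _ y).ge

theorem one_add_I_smul_inverse_apply {X : H →L[ℂ] H} (hX : 0 ≤ X) (x : H) :
    (1 + Complex.I • X) (Ring.inverse (1 + Complex.I • X) x) = x :=
  congrArg (fun M : H →L[ℂ] H => M x) (Ring.mul_inverse_cancel _ (isUnit_one_add_I_smul hX))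

theorem inverse_one_add_I_smul_apply {X : H →L[ℂ] H} (hX : 0 ≤ X) (x : H) :
    Ring.inverse (1 + Complex.I • X) ((1 + Complex.I • X) x) = x :=
  congrArg (fun M : H →L[ℂ] H => M x) (Ring.inverse_mul_cancel _ (isUnit_one_add_I_smul hX))

/-- Substitute `x = (1 + iX)y`: the real part is `‖y‖²` and the imaginary part is at most `(Xy, y) ≤
‖y‖²` in modulus. -/
theorem inner_inverse_one_add_I_smul {X : H →L[ℂ] H} (hX : 0 ≤ X) (hX1 : ‖X‖ ≤ 1) (x : H) :
    (inner ℂ x (Ring.inverse (1 + Complex.I • X) x)).re =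
      ‖Ring.inverse (1 + Complex.I • X) x‖ ^ 2 ∧
    |(inner ℂ x (Ring.inverse (1 + Complex.I • X) x)).im| ≤
      ‖Ring.inverse (1 + Complex.I • X) x‖ ^ 2 := by
  have e := one_add_I_smul_inverse_apply hX x
  generalize Ring.inverse (1 + Complex.I • X) x = y at e
  have e2 : inner ℂ x y = ((‖y‖ ^ 2 : ℝ) : ℂ) - Complex.I * (inner ℂ y (X y)).re := by
    rw [← e, add_apply, one_apply_eq_self, smul_apply, inner_add_left, inner_smul_left,
      Complex.conj_I, inner_self_eq_norm_sq_to_K, neg_mul, ← sub_eq_add_neg,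
      ← inner_conj_symm, Complex.conj_eq_iff_real.2
        ⟨_, Complex.ext (Complex.ofReal_re _).symm (im_inner_eq_zero_of_nonneg hX y)⟩]
    congr 1
    · simp
    · congr 1
      exact Complex.ext (Complex.ofReal_re _).symm (im_inner_eq_zero_of_nonneg hX y)
  rw [e2, Complex.sub_re, Complex.sub_im, Complex.I_mul_re, Complex.I_mul_im, Complex.ofReal_re,
    Complex.ofReal_im, Complex.ofReal_re, Complex.ofReal_im, neg_zero, sub_zero, zero_sub, abs_neg]
  refine ⟨rfl, (Complex.abs_re_le_norm _).trans ((norm_inner_le_norm _ _).trans ?_)⟩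
  rw [sq]
  exact mul_le_mul_of_nonneg_left ((X.le_of_opNorm_le hX1 y).trans_eq (one_mul _)) (norm_nonneg _)

/-- If `X` is a positive contraction, the form `((1 + iX)⁻¹ G⁻¹ u, G⁻¹ v)` is closed and
sectorial on the range of `G`. -/
def closedSectorialFormOfRange (G X : H →L[ℂ] H) (hG : Function.Injective G)
    (hd : DenseRange G) (hX : 0 ≤ X) (hX1 : ‖X‖ ≤ 1) : ClosedSectorialForm H where
  domain := LinearMap.range (G : H →ₗ[ℂ] H)
  form := rangeForm G (Ring.inverse (1 + Complex.I • X)) hG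
  dense := hd
  sectorial := by
    refine ⟨Real.pi / 4, by positivity, by linarith [Real.pi_pos], ?_⟩
    rintro ⟨_, x, rfl⟩
    obtain ⟨h1, h2⟩ := inner_inverse_one_add_I_smul hX hX1 x
    rw [rangeForm_apply hG (u := x) (v := x) rfl rfl, Real.tan_pi_div_four, one_mul, h1]
    exact ⟨sq_nonneg _, h2⟩
  closed := by
    intro u x hux hu
    choose w hw using fun n => (u n).2
    set N := Ring.inverse (1 + Complex.I • X) with hN
    have hform : ∀ p q, rangeForm G N hG (u p - u q) (u p - u q) =
        inner ℂ (w p - w q) (N (w p - w q)) := fun p q => by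
      have : ((u p - u q : LinearMap.range (G : H →ₗ[ℂ] H)) : H) = G (w p - w q) := by
        rw [map_sub, Submodule.coe_sub, ← hw p, ← hw q]
        rfl
      exact rangeForm_apply hG this this
    -- The real part of the form at `u p - u q` is exactly `‖N(w p - w q)‖²`, so form-Cauchy means
    -- that `N (w n)` is Cauchy.
    have hcauchy : CauchySeq fun n => N (w n) := by
      rw [cauchySeq_iff_tendsto_dist_atTop_0]
      have h1 := (Complex.continuous_re.tendsto _).comp hu
      have h2 := h1.sqrt
      simp only [Complex.zero_re, Real.sqrt_zero] at h2
      refine h2.congr fun p => ?_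
      rw [Function.comp_apply, hform, (inner_inverse_one_add_I_smul hX hX1 _).1,
        Real.sqrt_sq (norm_nonneg _), ← hN, map_sub, dist_eq_norm]
    obtain ⟨y, hy⟩ := cauchySeq_tendsto_of_complete hcauchy
    set x₀ := (1 + Complex.I • X) y with hx₀
    have hwx : Tendsto w atTop (𝓝 x₀) := by
      refine (((1 + Complex.I • X).continuous.tendsto y).comp hy).congr fun n => ?_
      exact one_add_I_smul_inverse_apply hX (w n)
    have hG0 : G x₀ = x := by
      refine tendsto_nhds_unique ?_ hux
      exact ((G.continuous.tendsto x₀).comp hwx).congr fun n => hw n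
    refine ⟨⟨x, x₀, hG0⟩, rfl, ?_⟩
    have hlim : Tendsto (fun n => inner ℂ (w n - x₀) (N (w n - x₀))) atTop (𝓝 0) := by
      have h1 : Tendsto (fun n => w n - x₀) atTop (𝓝 0) := by
        simpa using hwx.sub_const x₀
      have h2 := h1.inner (𝕜 := ℂ) ((N.continuous.tendsto 0).comp h1)
      simp only [map_zero, inner_zero_left] at h2
      exact h2
    refine hlim.congr fun n => ?_
    have : ((u n - ⟨x, x₀, hG0⟩ : LinearMap.range (G : H →ₗ[ℂ] H)) : H) = G (w n - x₀) := by
      rw [map_sub, Submodule.coe_sub, ← hw n, hG0]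
      rfl
    exact (rangeForm_apply hG this this).symm

/-- With `G = B^{1/2}`, the factorization `BK = GXG` gives `T = G(1 + iX)G`, so the form of `T⁻¹` is
`((1 + iX)⁻¹G⁻¹u, G⁻¹v)` on `ran G`. Only `X` depends on `K`. -/
theorem IsSymmetrizedIsometry.exists_isAssociated {B K : H →L[ℂ] H}
    (h : IsSymmetrizedIsometry B K) :
    ∃ a : ClosedSectorialForm H, IsAssociated a (opInv (rotated B K)) ∧
      a.domain = LinearMap.range ((CFC.sqrt B : H →L[ℂ] H) : H →ₗ[ℂ] H) := by
  obtain ⟨X, hX, hX1, e⟩ := exists_eq_sqrt_mul_mul_sqrt h.nonneg h.injective h.mul_nonneg h.mul_le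
  have hi := sqrt_injective h.nonneg h.injective
  have ha := adjoint_eq_of_nonneg (CFC.sqrt_nonneg B)
  have hd := denseRange_of_adjoint_eq_of_injective ha hi
  refine ⟨closedSectorialFormOfRange (CFC.sqrt B) X hi hd hX hX1,
    ⟨h.isMAccretive_opInv_rotated, h.isSectorial_opInv_rotated, fun u => ?_⟩, rfl⟩
  obtain ⟨w, hw⟩ := (mem_domain_opInv h.rotated_injective).1 u.2
  have hSu : opInv (rotated B K) u = w :=
    h.rotated_injective ((apply_opInv h.rotated_injective u).trans hw.symm)
  have hu : (u : H) = CFC.sqrt B ((1 + Complex.I • X) (CFC.sqrt B w)) := by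
    rw [← hw, rotated, e, add_apply, ← sqrt_sqrt_apply h.nonneg, smul_apply, add_apply,
      map_add, smul_apply, map_smul]
    rfl
  refine ⟨⟨u, _, hu.symm⟩, rfl, ?_⟩
  rintro ⟨_, v, rfl⟩
  refine (rangeForm_apply hi hu (v := v) rfl).trans ?_
  rw [inverse_one_add_I_smul_apply hX, hSu]
  change _ = inner ℂ (CFC.sqrt B v) w
  rw [← ContinuousLinearMap.adjoint_inner_left, ha]

end Form

/-! ### Power series along a geometric sequence -/

section LeadingTerm

/-- The leading term of a power series along the geometric sequence `2⁻ʲ`. -/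
theorem tendsto_tsum_mul_two_pow {d : ℕ → ℂ} (hd : Summable fun m => ‖d m‖) {k : ℕ}
    (hk : ∀ m < k, d m = 0) :
    Tendsto (fun j : ℕ => (∑' m, d m * ((2 : ℂ)⁻¹ ^ j) ^ m) * (2 ^ j) ^ k) atTop (𝓝 (d k)) := by
  have hpow : ∀ j m : ℕ, k ≤ m →
      d m * ((2 : ℂ)⁻¹ ^ j) ^ m * (2 ^ j) ^ k = d m * ((2 : ℂ)⁻¹ ^ j) ^ (m - k) := by
    intro j m hm
    obtain ⟨l, rfl⟩ := Nat.exists_eq_add_of_le hm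
    rw [Nat.add_sub_cancel_left, pow_add, inv_pow, inv_pow]
    have : ((2 : ℂ) ^ j) ^ k ≠ 0 := pow_ne_zero _ (pow_ne_zero _ two_ne_zero)
    field_simp
  have h2 : ‖(2 : ℂ)⁻¹‖ < 1 := by norm_num
  have hlim : ∑' m, (if m = k then d m else 0) = d k := by
    rw [tsum_ite_eq]
  simp_rw [← tsum_mul_right]
  rw [← hlim]
  refine tendsto_tsum_of_dominated_convergence hd (fun m => ?_) (Eventually.of_forall fun j m => ?_)
  · rcases lt_trichotomy m k with hm | rfl | hm
    · simp [hk m hm]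
    · simp
    · rw [if_neg hm.ne']
      simp_rw [hpow _ m hm.le]
      have h3 : Tendsto (fun j : ℕ => ((2 : ℂ)⁻¹ ^ j) ^ (m - k)) atTop (𝓝 0) := by
        have := (tendsto_pow_atTop_nhds_zero_of_norm_lt_one h2).pow (m - k)
        rwa [zero_pow (Nat.sub_pos_of_lt hm).ne'] at this
      simpa using h3.const_mul (d m)
  · rcases lt_or_ge m k with hm | hm
    · simp [hk m hm]
    · rw [hpow j m hm, norm_mul, norm_pow, norm_pow]
      exact mul_le_of_le_one_right (norm_nonneg _)
        (pow_le_one₀ (by positivity) (pow_le_one₀ (norm_nonneg _) h2.le))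

/-- If the values of a power series at `4⁻ⁿ` and at `2⁻¹ 4⁻ⁿ` are linearly dependent with
the weights `1` and `1 / (2n + 1)`, then the series vanishes. -/
theorem eq_zero_of_forall_tsum_dependent {d : ℕ → ℂ} (hd : Summable fun m => ‖d m‖) {α β : ℂ}
    (hαβ : α ≠ 0 ∨ β ≠ 0)
    (h : ∀ n : ℕ, α * (∑' m, d m * ((2 : ℂ)⁻¹ ^ (2 * n)) ^ m) +
      β * ((2 * n + 1 : ℕ) : ℂ)⁻¹ * (∑' m, d m * ((2 : ℂ)⁻¹ ^ (2 * n + 1)) ^ m) = 0) : d = 0 := by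
  by_contra hne
  have hex : ∃ k, d k ≠ 0 := Function.ne_iff.1 hne
  classical
  set k := Nat.find hex
  have hk : d k ≠ 0 := Nat.find_spec hex
  have hT := tendsto_tsum_mul_two_pow hd (k := k) fun m hm => not_not.1 (Nat.find_min hex hm)
  have he : Tendsto (fun n : ℕ => 2 * n) atTop atTop :=
    tendsto_atTop_mono (fun n => show n ≤ 2 * n by omega) tendsto_id
  have ho : Tendsto (fun n : ℕ => 2 * n + 1) atTop atTop := (tendsto_add_atTop_nat 1).comp he
  have hTe := hT.comp he
  have hTo := hT.comp ho
  by_cases hα : α = 0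
  · have hβ : β ≠ 0 := hαβ.resolve_left (not_not.2 hα)
    refine hk (tendsto_nhds_unique hTo ?_)
    refine tendsto_const_nhds.congr fun n => ?_
    have := h n
    rw [hα, zero_mul, zero_add, mul_eq_zero, mul_eq_zero] at this
    have hn : ((2 * n + 1 : ℕ) : ℂ)⁻¹ ≠ 0 := inv_ne_zero (Nat.cast_ne_zero.2 (by omega))
    rw [Function.comp_apply, this.resolve_left (by tauto), zero_mul]
  · have h0 : Tendsto (fun n : ℕ => ((2 * n + 1 : ℕ) : ℂ)⁻¹) atTop (𝓝 0) :=
      (tendsto_inv_atTop_nhds_zero_nat (𝕜 := ℂ)).comp ho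
    -- After multiplication by `4^{nk}`, the even values tend to `d k`, while the odd ones stay
    -- bounded and carry the factor `1/(2n + 1)`. Hence `α d k = 0`.
    have h1 : Tendsto (fun n : ℕ => -β * (2 ^ k)⁻¹ * ((2 * n + 1 : ℕ) : ℂ)⁻¹ *
        ((∑' m, d m * ((2 : ℂ)⁻¹ ^ (2 * n + 1)) ^ m) * (2 ^ (2 * n + 1)) ^ k)) atTop (𝓝 0) := by
      simpa using (h0.const_mul (-β * (2 ^ k)⁻¹)).mul hTo
    refine mul_ne_zero hα hk (tendsto_nhds_unique ((hTe.const_mul α).congr fun n => ?_) h1)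
    have e := eq_neg_of_add_eq_zero_left (h n)
    have e2 : ((2 : ℂ) ^ (2 * n + 1)) ^ k = (2 ^ (2 * n)) ^ k * 2 ^ k := by
      rw [pow_succ, mul_pow]
    have e3 : ((2 : ℂ) ^ k)⁻¹ * 2 ^ k = 1 := inv_mul_cancel₀ (pow_ne_zero _ two_ne_zero)
    rw [Function.comp_apply, ← mul_assoc, e, e2]
    linear_combination (β * ((2 * n + 1 : ℕ) : ℂ)⁻¹ *
      (∑' m, d m * ((2 : ℂ)⁻¹ ^ (2 * n + 1)) ^ m) * (2 ^ (2 * n)) ^ k) * e3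

end LeadingTerm

/-! ### A Hilbert basis indexed by the natural numbers -/

theorem countable_of_orthonormal [TopologicalSpace.SeparableSpace H] {ι : Type*}
    {v : ι → H} (hv : Orthonormal ℂ v) : Countable ι := by
  have hdist : ∀ i j, i ≠ j → 1 ≤ dist (v i) (v j) := by
    intro i j hij
    have h1 := @norm_sub_sq ℂ H _ _ _ (v i) (v j)
    rw [hv.2 hij, hv.1, hv.1, map_zero] at h1
    rw [dist_eq_norm]
    nlinarith [norm_nonneg (v i - v j)]
  have hdisj : (Set.univ : Set ι).PairwiseDisjoint fun i => Metric.ball (v i) (1 / 2) := by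
    intro i _ j _ hij
    exact Metric.ball_disjoint_ball (by linarith [hdist i j hij])
  exact Set.countable_univ_iff.1 (hdisj.countable_of_isOpen (fun i _ => Metric.isOpen_ball)
    fun i _ => ⟨v i, Metric.mem_ball_self (by norm_num)⟩)

theorem exists_hilbertBasis_nat [CompleteSpace H] [TopologicalSpace.SeparableSpace H]
    (hH : ¬ FiniteDimensional ℂ H) : Nonempty (HilbertBasis ℕ ℂ H) := by
  obtain ⟨w, b, -⟩ := exists_hilbertBasis ℂ H
  have hc : Countable w := countable_of_orthonormal b.orthonormal
  have hi : Infinite w := by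
    by_contra hf
    rw [not_infinite_iff_finite] at hf
    have := Fintype.ofFinite w
    exact hH (Module.Finite.of_basis b.toOrthonormalBasis.toBasis)
  obtain ⟨e⟩ := nonempty_equiv_of_countable (α := ℕ) (β := w)
  refine ⟨HilbertBasis.mk (b.orthonormal.comp e e.injective) ?_⟩
  rw [e.surjective.range_comp, b.dense_span]

/-! ### An operator with independent even and odd components -/

section Basis

variable (b : HilbertBasis ℕ ℂ H)

theorem ext_inner_hilbertBasis {x y : H} (h : ∀ n, inner ℂ (b n) x = inner ℂ (b n) y) : x = y := by
  apply b.repr.injective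
  ext n
  rw [b.repr_apply_apply, b.repr_apply_apply, h]

/-- The weights `1 / n!`. -/
def weight (n : ℕ) : ℂ := ((n.factorial : ℕ) : ℂ)⁻¹

theorem summable_norm_weight : Summable fun n => ‖weight n‖ := by
  refine (Real.summable_pow_div_factorial 1).congr fun n => ?_
  simp [weight]

theorem weight_ne_zero (n : ℕ) : weight n ≠ 0 :=
  inv_ne_zero (Nat.cast_ne_zero.2 n.factorial_ne_zero)

/-- The ratio of consecutive weights tends to `0`; this separates odd components from even ones. -/
theorem weight_succ (n : ℕ) : weight (n + 1) = ((n + 1 : ℕ) : ℂ)⁻¹ * weight n := by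
  rw [weight, Nat.factorial_succ, Nat.cast_mul, mul_inv, weight]

theorem norm_inner_basis_le (n : ℕ) (u : H) : ‖inner ℂ (b n) u‖ ≤ ‖u‖ := by
  simpa [b.orthonormal.1 n] using norm_inner_le_norm (𝕜 := ℂ) (b n) u

theorem summable_norm_weight_mul_inner (u : H) :
    Summable fun m => ‖weight m * inner ℂ (b m) u‖ := by
  refine (summable_norm_weight.mul_right ‖u‖).of_nonneg_of_le (fun m => norm_nonneg _) fun m => ?_
  rw [norm_mul]
  exact mul_le_mul_of_nonneg_left (norm_inner_basis_le b m u) (norm_nonneg _)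

variable [CompleteSpace H]

theorem exists_isometry_of_injective {φ : ℕ → ℕ} (hφ : Function.Injective φ) :
    ∃ J : H →L[ℂ] H, (∀ x, ‖J x‖ = ‖x‖) ∧ ∀ n, J (b n) = b (φ n) := by
  have hv := b.orthonormal.comp φ hφ
  refine ⟨(hv.orthogonalFamily.linearIsometry.comp b.repr.toLinearIsometry).toContinuousLinearMap,
    fun x => LinearIsometry.norm_map _ x, fun n => ?_⟩
  change hv.orthogonalFamily.linearIsometry (b.repr (b n)) = _
  classical
  rw [b.repr_self, OrthogonalFamily.linearIsometry_apply_single]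
  simp

/-- The operator with the matrix `2⁻ʲᵐ / (j! m!)`. -/
theorem exists_matrix_operator :
    ∃ Z : H →L[ℂ] H, ∀ j u, inner ℂ (b j) (Z u) =
      weight j * ∑' m, weight m * inner ℂ (b m) u * ((2 : ℂ)⁻¹ ^ j) ^ m := by
  have h2 : ‖(2 : ℂ)⁻¹‖ ≤ 1 := by norm_num
  have hle : ∀ j m : ℕ, ‖((2 : ℂ)⁻¹ ^ j) ^ m‖ ≤ 1 := fun j m => by
    rw [norm_pow, norm_pow]
    exact pow_le_one₀ (by positivity) (pow_le_one₀ (norm_nonneg _) h2)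
  have hs : ∀ j, Summable fun m => (weight m * ((2 : ℂ)⁻¹ ^ j) ^ m) • innerSL ℂ (b m) := by
    intro j
    refine Summable.of_norm_bounded summable_norm_weight fun m => ?_
    rw [norm_smul, norm_mul, innerSL_apply_norm, b.orthonormal.1, mul_one]
    exact mul_le_of_le_one_right (norm_nonneg _) (hle j m)
  set f : ℕ → (H →L[ℂ] ℂ) := fun j => ∑' m, (weight m * ((2 : ℂ)⁻¹ ^ j) ^ m) • innerSL ℂ (b m)
    with hf
  have hfa : ∀ j u, f j u = ∑' m, weight m * inner ℂ (b m) u * ((2 : ℂ)⁻¹ ^ j) ^ m := by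
    intro j u
    have := ((ContinuousLinearMap.apply ℂ ℂ u).hasSum (hs j).hasSum).tsum_eq
    simp only [ContinuousLinearMap.apply_apply, smul_apply, innerSL_apply_apply, smul_eq_mul]
      at this
    rw [hf, ← this]
    exact tsum_congr fun m => by ring
  have hfn : ∀ j, ‖f j‖ ≤ ∑' m, ‖weight m‖ := fun j =>
    tsum_of_norm_bounded summable_norm_weight.hasSum fun m => by
      rw [norm_smul, norm_mul, innerSL_apply_norm, b.orthonormal.1, mul_one]
      exact mul_le_of_le_one_right (norm_nonneg _) (hle j m)
  have hsZ : Summable fun j => weight j • (f j).smulRight (b j) := by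
    refine Summable.of_norm_bounded (summable_norm_weight.mul_right (∑' m, ‖weight m‖))
      fun j => ?_
    rw [norm_smul, ContinuousLinearMap.norm_smulRight_apply, b.orthonormal.1, mul_one]
    exact mul_le_mul_of_nonneg_left (hfn j) (norm_nonneg _)
  refine ⟨∑' j, weight j • (f j).smulRight (b j), fun j u => ?_⟩
  have h1 := (ContinuousLinearMap.apply ℂ H u).hasSum hsZ.hasSum
  have h3 := ((innerSL ℂ (b j)).hasSum h1).tsum_eq
  simp only [ContinuousLinearMap.apply_apply, smul_apply, innerSL_apply_apply,
    ContinuousLinearMap.smulRight_apply, inner_smul_right] at h3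
  rw [← h3, tsum_eq_single j, ← hfa]
  · rw [inner_self_eq_norm_sq_to_K, b.orthonormal.1]
    simp
  · intro i hi
    rw [b.orthonormal.2 hi.symm]
    simp

/-- The matrix `2⁻ʲᵐ / (j! m!)` is real and symmetric. -/
theorem adjoint_eq_of_inner_basis {Z : H →L[ℂ] H} (hZ : ∀ j u, inner ℂ (b j) (Z u) =
      weight j * ∑' m, weight m * inner ℂ (b m) u * ((2 : ℂ)⁻¹ ^ j) ^ m) : Z† = Z := by
  have hjm : ∀ j m, inner ℂ (b j) (Z (b m)) = weight j * (weight m * ((2 : ℂ)⁻¹ ^ j) ^ m) := by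
    intro j m
    rw [hZ, tsum_eq_single m]
    · rw [inner_self_eq_norm_sq_to_K, b.orthonormal.1]
      simp
    · intro i hi
      rw [b.orthonormal.2 hi]
      simp
  have hspan : Dense (Submodule.span ℂ (Set.range b) : Set H) :=
    Submodule.dense_iff_topologicalClosure_eq_top.2 b.dense_span
  refine ContinuousLinearMap.ext_on hspan ?_
  rintro _ ⟨m, rfl⟩
  refine ext_inner_hilbertBasis b fun j => ?_
  rw [ContinuousLinearMap.adjoint_inner_right, ← inner_conj_symm, hjm, hjm]
  simp only [weight, map_mul, map_pow, map_inv₀, map_natCast, map_ofNat]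
  rw [← pow_mul, ← pow_mul, mul_comm m j]
  ring

/-- A self-adjoint operator `Z` and two isometries with orthogonal ranges such that the components
of `Z u` along the two ranges are never linearly dependent. -/
theorem exists_operator_with_independent_components (b : HilbertBasis ℕ ℂ H) :
    ∃ Z J₁ J₂ : H →L[ℂ] H, Z† = Z ∧ Function.Injective Z ∧ (∀ x, ‖J₁ x‖ = ‖x‖) ∧
      (∀ x, ‖J₂ x‖ = ‖x‖) ∧ (∀ x, (J₁†) (J₂ x) = 0) ∧
      ∀ (α β : ℂ) (u : H), (α ≠ 0 ∨ β ≠ 0) → α • (J₁†) (Z u) + β • (J₂†) (Z u) = 0 → u = 0 := by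
  obtain ⟨Z, hZ⟩ := exists_matrix_operator b
  obtain ⟨J₁, hJ₁, hb₁⟩ := exists_isometry_of_injective b (φ := fun n => 2 * n)
    fun m n h => by simpa using h
  obtain ⟨J₂, hJ₂, hb₂⟩ := exists_isometry_of_injective b (φ := fun n => 2 * n + 1)
    fun m n h => by simpa using h
  have hind : ∀ (α β : ℂ) (u : H), (α ≠ 0 ∨ β ≠ 0) →
      α • (J₁†) (Z u) + β • (J₂†) (Z u) = 0 → u = 0 := by
    intro α β u hαβ hu
    have hd : (fun m => weight m * inner ℂ (b m) u) = 0 := by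
      -- The `n`-th coordinate of the relation involves the coordinates `2n` and `2n + 1` of `Zu`;
      -- dividing by `weight (2 * n)` leaves the factor `1/(2n + 1)`.
      refine eq_zero_of_forall_tsum_dependent (summable_norm_weight_mul_inner b u) hαβ fun n => ?_
      have h1 := congrArg (inner ℂ (b n)) hu
      rw [inner_add_right, inner_smul_right, inner_smul_right,
        ContinuousLinearMap.adjoint_inner_right, ContinuousLinearMap.adjoint_inner_right, hb₁, hb₂,
        hZ, hZ, weight_succ, inner_zero_right] at h1
      refine (mul_eq_zero.1 ?_).resolve_left (weight_ne_zero (2 * n))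
      linear_combination h1
    refine ext_inner_hilbertBasis b fun m => ?_
    rw [inner_zero_right]
    exact (mul_eq_zero.1 (congrFun hd m)).resolve_left (weight_ne_zero m)
  refine ⟨Z, J₁, J₂, adjoint_eq_of_inner_basis b hZ, ?_, hJ₁, hJ₂, ?_, hind⟩
  · rw [injective_iff_map_eq_zero]
    intro u hu
    exact hind 1 0 u (Or.inl one_ne_zero) (by rw [hu]; simp)
  · intro x
    refine ext_inner_hilbertBasis b fun n => ?_
    have h0 : (J₂†) (b (2 * n)) = 0 := by
      refine ext_inner_hilbertBasis b fun m => ?_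
      rw [ContinuousLinearMap.adjoint_inner_right, hb₂, inner_zero_right]
      exact b.orthonormal.2 (by omega)
    rw [ContinuousLinearMap.adjoint_inner_right, hb₁, ← ContinuousLinearMap.adjoint_inner_left, h0,
      inner_zero_left, inner_zero_right]

end Basis

/-! ### Symmetrizing an isometry by polar decomposition -/

section Polar

variable [CompleteSpace H] {B W : H →L[ℂ] H}

theorem mul_isometry_mul_adjoint_mul_nonneg (hB : 0 ≤ B) : 0 ≤ B * (W * W†) * B := by
  have e : B * (W * W†) * B = star (W† * B) * (W† * B) := by
    rw [star_mul, ContinuousLinearMap.star_eq_adjoint, ContinuousLinearMap.star_eq_adjoint,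
      ContinuousLinearMap.adjoint_adjoint, adjoint_eq_of_nonneg hB]
    simp only [mul_assoc]
  rw [e]
  exact star_mul_self_nonneg _

/-- The polar decomposition of `W W* B` yields an isometry `K` with the range of `W` such that
`B K = (B W W* B)^{1/2}`. -/
theorem exists_isSymmetrizedIsometry (hB : 0 ≤ B) (hi : Function.Injective B)
    (hW : ∀ x, ‖W x‖ = ‖x‖) (h1 : ∀ x, (W†) (B x) = 0 → x = 0)
    (h2 : ∀ x y, B x = W y → x = 0) :
    ∃ K : H →L[ℂ] H, IsSymmetrizedIsometry B K ∧ B * K = CFC.sqrt (B * (W * W†) * B) ∧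
      Set.range K = Set.range W := by
  set M := B * (W * W†) * B with hM
  have hM0 : 0 ≤ M := mul_isometry_mul_adjoint_mul_nonneg hB
  set C := CFC.sqrt M with hC
  have hC0 : 0 ≤ C := CFC.sqrt_nonneg M
  have hBa := adjoint_eq_of_nonneg hB
  have hCa := adjoint_eq_of_nonneg hC0
  have hWW := adjoint_apply_apply_of_isometry hW
  have hnorm : ∀ x, ‖(W * W† * B) x‖ = ‖C x‖ := by
    intro x
    have e : inner ℂ x (M x) = ((‖(W†) (B x)‖ ^ 2 : ℝ) : ℂ) := by
      change inner ℂ x (B (W ((W†) (B x)))) = _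
      rw [← ContinuousLinearMap.adjoint_inner_left, hBa, ← ContinuousLinearMap.adjoint_inner_left,
        inner_self_eq_norm_sq_to_K]
      simp
    have e2 := re_inner_eq_norm_sqrt_sq hM0 x
    rw [e, Complex.ofReal_re] at e2
    change ‖W ((W†) (B x))‖ = _
    rw [hW]
    exact (pow_left_inj₀ (norm_nonneg _) (norm_nonneg _) two_ne_zero).1 e2
  have hCi : Function.Injective C := by
    rw [injective_iff_map_eq_zero]
    intro x hx
    apply h1
    rw [← norm_eq_zero, ← hW]
    exact (hnorm x).trans (by rw [hx, norm_zero])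
  have hCd := denseRange_of_adjoint_eq_of_injective hCa hCi
  have hle : ∀ x, ‖(W * W† * B) x‖ ≤ 1 * ‖C x‖ := fun x => by rw [hnorm, one_mul]
  -- By `hnorm` the map `Cx ↦ WW*Bx` is isometric on the dense range of `C`, so it extends to an
  -- isometry.
  set K : H →L[ℂ] H := ((W * W† * B : H →L[ℂ] H) : H →ₗ[ℂ] H).extendOfNorm (C : H →ₗ[ℂ] H)
  have hKC : ∀ x, K (C x) = W ((W†) (B x)) := fun x =>
    LinearMap.extendOfNorm_eq hCd ⟨1, hle⟩ x
  have hK : ∀ x, ‖K x‖ = ‖x‖ := fun x =>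
    hCd.induction_on (p := fun x => ‖K x‖ = ‖x‖) x
      (isClosed_eq K.continuous.norm continuous_norm) fun y => by
        rw [hKC]
        exact hnorm y
  have hPK : ∀ x, W ((W†) (K x)) = K x := fun x =>
    hCd.induction_on (p := fun x => W ((W†) (K x)) = K x) x
      (isClosed_eq (by fun_prop) (by fun_prop)) fun y => by
        rw [hKC, hWW]
  have hKB : K† * B = C := by
    ext x
    refine ext_inner_left ℂ fun y => ?_
    rw [mul_apply_eq_comp, ContinuousLinearMap.adjoint_inner_right, ← hPK,
      ← ContinuousLinearMap.adjoint_inner_right, ← ContinuousLinearMap.adjoint_inner_right,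
      ContinuousLinearMap.adjoint_adjoint, ← hKC, ← ContinuousLinearMap.adjoint_inner_right,
      adjoint_apply_apply_of_isometry hK]
  have hBK : B * K = C := by
    rw [← hCa, ← hKB, ← ContinuousLinearMap.star_eq_adjoint, star_mul,
      ContinuousLinearMap.star_eq_adjoint, ContinuousLinearMap.star_eq_adjoint,
      ContinuousLinearMap.adjoint_adjoint, hBa]
  have hBd := denseRange_of_adjoint_eq_of_injective hBa hi
  -- On the dense range of `B`, `KK*B = KC = WW*B`; so the range projections of `K` and `W`
  -- coincide.
  have hKK : ∀ x, K ((K†) x) = W ((W†) x) := fun x =>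
    hBd.induction_on (p := fun x => K ((K†) x) = W ((W†) x)) x
      (isClosed_eq (by fun_prop) (by fun_prop)) fun y => by
        rw [← hKC, ← hKB]
        rfl
  refine ⟨K, ⟨hB, hi, hK, hBK ▸ hC0, ?_, fun x y hxy => h2 x ((W†) (K y)) (by rw [hPK, hxy])⟩,
    hBK, ?_⟩
  · have hP : W† * W = 1 := by
      ext x
      exact hWW x
    -- `WW*` is a projection, so `B² - M = B(1 - WW*)B ≥ 0`; operator monotonicity of the square
    -- root turns this into `C ≤ B`.
    have hle : M ≤ B * B := by
      rw [← sub_nonneg]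
      have e : B * B - M = star ((1 - W * W†) * B) * ((1 - W * W†) * B) := by
        have e1 : star ((1 - W * W†) * B) = B * (1 - W * W†) := by
          rw [star_mul, star_sub, star_one, star_mul, ContinuousLinearMap.star_eq_adjoint,
            ContinuousLinearMap.star_eq_adjoint, ContinuousLinearMap.star_eq_adjoint,
            ContinuousLinearMap.adjoint_adjoint, hBa]
        have e2 : W * W† * (W * W†) = W * W† := by
          rw [mul_assoc, ← mul_assoc (W†), hP, one_mul]
        have e3 : (1 - W * W†) * (1 - W * W†) = 1 - W * W† := by
          rw [sub_mul, mul_sub, mul_sub, e2]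
          simp
        rw [e1, mul_assoc, ← mul_assoc (1 - W * W†), e3, hM, sub_mul, one_mul, mul_sub, mul_assoc]
      rw [e]
      exact star_mul_self_nonneg _
    rw [hBK, hC, ← CFC.sqrt_mul_self B hB]
    exact CFC.sqrt_le_sqrt _ _ hle
  · ext x
    constructor
    · rintro ⟨y, rfl⟩
      exact ⟨_, hPK y⟩
    · rintro ⟨y, rfl⟩
      exact ⟨(K†) (W y), by rw [hKK, hWW]⟩

theorem continuous_sqrt_mul_isometry_mul_adjoint_mul {X : Type*} [TopologicalSpace X]
    {W : X → (H →L[ℂ] H)} (hB : 0 ≤ B) (hW : Continuous W) :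
    Continuous fun ξ => CFC.sqrt (B * (W ξ * (W ξ)†) * B) :=
  CFC.continuousOn_sqrt.comp_continuous
    (by
      have : Continuous fun ξ => (W ξ)† := ContinuousLinearMap.adjoint.continuous.comp hW
      fun_prop)
    fun ξ => mul_isometry_mul_adjoint_mul_nonneg hB

end Polar

/-! ### Isometries onto graphs, and the family -/

section Graph

variable {J₁ J₂ : H →L[ℂ] H}

/-- The isometry `(J₁ + ξ J₂) / √(1 + |ξ|²)` onto the graph of multiplication by `ξ`. -/
def graphIsometry (J₁ J₂ : H →L[ℂ] H) (ξ : ℂ) : H →L[ℂ] H :=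
  (((Real.sqrt (1 + ‖ξ‖ ^ 2))⁻¹ : ℝ) : ℂ) • (J₁ + ξ • J₂)

theorem sqrt_one_add_norm_sq_pos (ξ : ℂ) : 0 < Real.sqrt (1 + ‖ξ‖ ^ 2) :=
  Real.sqrt_pos.2 (by positivity)

theorem continuous_graphIsometry : Continuous (graphIsometry J₁ J₂) := by
  unfold graphIsometry
  have : Continuous fun ξ : ℂ => (Real.sqrt (1 + ‖ξ‖ ^ 2))⁻¹ :=
    Continuous.inv₀ (by fun_prop) fun ξ => (sqrt_one_add_norm_sq_pos ξ).ne'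
  exact (Complex.continuous_ofReal.comp this).smul (by fun_prop)

theorem graphIsometry_apply_smul (ξ : ℂ) (x : H) :
    graphIsometry J₁ J₂ ξ (((Real.sqrt (1 + ‖ξ‖ ^ 2) : ℝ) : ℂ) • x) = J₁ x + ξ • J₂ x := by
  have := sqrt_one_add_norm_sq_pos ξ
  rw [graphIsometry, smul_apply, map_smul, smul_smul, ← Complex.ofReal_mul,
    inv_mul_cancel₀ this.ne', Complex.ofReal_one, one_smul]
  rfl

theorem graphIsometry_apply (ξ : ℂ) (x : H) : graphIsometry J₁ J₂ ξ x =
    J₁ ((((Real.sqrt (1 + ‖ξ‖ ^ 2))⁻¹ : ℝ) : ℂ) • x) +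
      ξ • J₂ ((((Real.sqrt (1 + ‖ξ‖ ^ 2))⁻¹ : ℝ) : ℂ) • x) := by
  simp only [graphIsometry, smul_apply, add_apply, map_smul]
  module

theorem mem_range_graphIsometry {ξ : ℂ} {x : H} :
    x ∈ Set.range (graphIsometry J₁ J₂ ξ) ↔ ∃ y, J₁ y + ξ • J₂ y = x :=
  ⟨fun ⟨y, hy⟩ => ⟨_, (graphIsometry_apply ξ y).symm.trans hy⟩,
    fun ⟨y, hy⟩ => ⟨_, (graphIsometry_apply_smul ξ y).trans hy⟩⟩

variable [CompleteSpace H]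

theorem norm_graphIsometry_apply (h₁ : ∀ x, ‖J₁ x‖ = ‖x‖) (h₂ : ∀ x, ‖J₂ x‖ = ‖x‖)
    (h : ∀ x, (J₁†) (J₂ x) = 0) (ξ : ℂ) (x : H) : ‖graphIsometry J₁ J₂ ξ x‖ = ‖x‖ := by
  have hpos := sqrt_one_add_norm_sq_pos ξ
  have e : ‖J₁ x + ξ • J₂ x‖ = Real.sqrt (1 + ‖ξ‖ ^ 2) * ‖x‖ := by
    rw [← pow_left_inj₀ (norm_nonneg _) (by positivity) two_ne_zero, mul_pow,
      Real.sq_sqrt (by positivity), @norm_add_sq ℂ, inner_smul_right,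
      ← ContinuousLinearMap.adjoint_inner_right, h, inner_zero_right, mul_zero, map_zero, mul_zero,
      norm_smul, h₁, h₂]
    ring
  rw [graphIsometry, smul_apply, norm_smul, add_apply, smul_apply, e, Complex.norm_real,
    Real.norm_of_nonneg (by positivity), inv_mul_cancel_left₀ hpos.ne']

theorem graphIsometry_adjoint_apply_eq_zero {ξ : ℂ} {x : H}
    (hx : ((graphIsometry J₁ J₂ ξ)†) x = 0) :
    (1 : ℂ) • (J₁†) x + (starRingEnd ℂ ξ) • (J₂†) x = 0 := by
  refine ext_inner_left ℂ fun y => ?_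
  have := graphIsometry_apply_smul (J₁ := J₁) (J₂ := J₂) ξ y
  rw [inner_zero_right, inner_add_right, inner_smul_right, inner_smul_right, one_mul,
    ContinuousLinearMap.adjoint_inner_right, ContinuousLinearMap.adjoint_inner_right,
    ← inner_smul_left, ← inner_add_left, ← this, ← ContinuousLinearMap.adjoint_inner_right, hx,
    inner_zero_right]

theorem adjoint_apply_graph (h₁ : ∀ x, ‖J₁ x‖ = ‖x‖) (h₂ : ∀ x, ‖J₂ x‖ = ‖x‖)
    (h : ∀ x, (J₁†) (J₂ x) = 0) (ξ : ℂ) (x : H) :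
    (J₁†) (J₁ x + ξ • J₂ x) = x ∧ (J₂†) (J₁ x + ξ • J₂ x) = ξ • x := by
  have h' : (J₂†) (J₁ x) = 0 := by
    refine ext_inner_left ℂ fun y => ?_
    rw [ContinuousLinearMap.adjoint_inner_right, ← ContinuousLinearMap.adjoint_inner_left, h,
      inner_zero_left, inner_zero_right]
  rw [map_add, map_add, map_smul, map_smul, h, h', adjoint_apply_apply_of_isometry h₁,
    adjoint_apply_apply_of_isometry h₂, smul_zero, add_zero, zero_add]
  exact ⟨rfl, rfl⟩

end Graph

/-- The family of isometries symmetrized by one positive operator. -/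
theorem exists_family [CompleteSpace H] [TopologicalSpace.SeparableSpace H]
    (hH : ¬ FiniteDimensional ℂ H) :
    ∃ (B J₁ J₂ : H →L[ℂ] H) (K : ℂ → (H →L[ℂ] H)), (∀ ξ, IsSymmetrizedIsometry B (K ξ)) ∧
      (Continuous fun ξ => B * K ξ) ∧
      (∀ (ξ : ℂ) (x : H), (∃ y, K ξ y = x) ↔ ∃ y, J₁ y + ξ • J₂ y = x) ∧
      (∀ (ξ ζ : ℂ) (x y : H), J₁ x + ξ • J₂ x = J₁ y + ζ • J₂ y → x = y ∧ ξ • x = ζ • y) := by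
  obtain ⟨b⟩ := exists_hilbertBasis_nat hH
  obtain ⟨Z, J₁, J₂, hZ, hZi, h₁, h₂, h, hind⟩ := exists_operator_with_independent_components b
  -- Squaring gives positivity, and `Bx = Z(Zx)` keeps the independence property available with `u =
  -- Zx`.
  have hB : 0 ≤ Z * Z := by
    have := star_mul_self_nonneg Z
    rwa [ContinuousLinearMap.star_eq_adjoint, hZ] at this
  have hBi : Function.Injective (Z * Z) := hZi.comp hZi
  have hK : ∀ ξ, ∃ K : H →L[ℂ] H, IsSymmetrizedIsometry (Z * Z) K ∧
      (Z * Z) * K = CFC.sqrt (Z * Z * (graphIsometry J₁ J₂ ξ * (graphIsometry J₁ J₂ ξ)†) *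
        (Z * Z)) ∧ Set.range K = Set.range (graphIsometry J₁ J₂ ξ) := by
    intro ξ
    refine exists_isSymmetrizedIsometry hB hBi (norm_graphIsometry_apply h₁ h₂ h ξ) ?_ ?_
    · intro x hx
      exact (injective_iff_map_eq_zero Z).1 hZi x
        (hind _ _ (Z x) (Or.inl one_ne_zero) (graphIsometry_adjoint_apply_eq_zero hx))
    · intro x y hxy
      obtain ⟨w, hw⟩ := mem_range_graphIsometry.1 ⟨y, hxy.symm⟩
      obtain ⟨e1, e2⟩ := adjoint_apply_graph h₁ h₂ h ξ w
      -- The functional relation `ξJ₁* - J₂*` annihilates every `J₁w + ξJ₂w`, so it annihilates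
      -- `Z(Zx)`.
      refine (injective_iff_map_eq_zero Z).1 hZi x
        (hind ξ (-1) (Z x) (Or.inr (neg_ne_zero.2 one_ne_zero)) ?_)
      rw [show Z (Z x) = J₁ w + ξ • J₂ w from hw.symm, e1, e2]
      module
  choose K hK1 hK2 hK3 using hK
  refine ⟨Z * Z, J₁, J₂, K, hK1, ?_, fun ξ x => ?_, fun ξ ζ x y e => ?_⟩
  · simp_rw [hK2]
    exact continuous_sqrt_mul_isometry_mul_adjoint_mul hB continuous_graphIsometry
  · rw [← mem_range_graphIsometry, ← hK3]
    rfl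
  · obtain ⟨e1, e2⟩ := adjoint_apply_graph h₁ h₂ h ξ x
    obtain ⟨e3, e4⟩ := adjoint_apply_graph h₁ h₂ h ζ y
    exact ⟨by rw [← e1, e, e3], by rw [← e2, e, e4]⟩

theorem IsSymmetrizedIsometry.mem_imRange [CompleteSpace H] {B K : H →L[ℂ] H}
    (h : IsSymmetrizedIsometry B K) {x : H} :
    x ∈ imRange (rotated B K) ↔ ∃ y, (∃ z, K z = y) ∧ B y = x := by
  rw [imRange, h.imaginaryPart_rotated]
  exact ⟨fun ⟨z, hz⟩ => ⟨_, ⟨z, rfl⟩, hz⟩, fun ⟨y, ⟨z, hz⟩, hy⟩ => ⟨z, by rw [← hy, ← hz]; rfl⟩⟩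

end KatoSqrt

end

theorem mainTheorem7 (H : Type*) [NormedAddCommGroup H] [InnerProductSpace ℂ H] [CompleteSpace H]
    [TopologicalSpace.SeparableSpace H] (hH : ¬ FiniteDimensional ℂ H) :
    -- `A ξ` are the operators, `S ξ = A(ξ)^{1/2}`, `T ξ = A(ξ)^{-1/2}`
    ∃ (A S : ℂ → (H →ₗ.[ℂ] H)) (T : ℂ → (H →L[ℂ] H)),
      KatoSqrt.NormResolventContinuous A ∧
      (∀ ξ, KatoSqrt.IsMAccretive (A ξ) ∧ ¬ KatoSqrt.IsSectorial (A ξ) ∧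
        ¬ KatoSqrt.IsBounded (A ξ) ∧ ∃ R : H →L[ℂ] H, KatoSqrt.IsBoundedInverse (A ξ) R) ∧
      -- the square roots of `A ξ` and of its adjoint, and the inverse of the square root
      (∀ ξ, KatoSqrt.IsMAccretiveSqrt (A ξ) (S ξ) ∧
        KatoSqrt.IsMAccretiveSqrt (A ξ).adjoint (S ξ).adjoint ∧
        KatoSqrt.IsBoundedInverse (S ξ) (T ξ)) ∧
      (∀ ξ, (A ξ).domain ⊓ (A ξ).adjoint.domain = ⊥) ∧
      (∀ ξ, (S ξ).domain ≠ (S ξ).adjoint.domain) ∧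
      -- the real part is constant, and so is the domain of the closed form of `S ξ`
      (∀ ξ ζ, realPart (T ξ) = realPart (T ζ)) ∧
      (∃ a : ℂ → KatoSqrt.ClosedSectorialForm H,
        (∀ ξ, KatoSqrt.IsAssociated (a ξ) (S ξ)) ∧ ∀ ξ ζ, (a ξ).domain = (a ζ).domain) ∧
      -- the ranges of the imaginary parts
      (∀ ξ, Dense (KatoSqrt.imRange (T ξ) : Set H)) ∧
      (∀ ξ ζ, ξ ≠ ζ → KatoSqrt.imRange (T ξ) ⊓ KatoSqrt.imRange (T ζ) = ⊥) ∧
      (∃ K : Submodule ℂ H, ∀ ξ ζ, ξ ≠ ζ →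
        KatoSqrt.imRange (T ξ) ⊔ KatoSqrt.imRange (T ζ) = K) ∧
      -- the operators `A(ξ)^{1/2} A(ξ)^{*-1/2}`
      (∀ ξ, KatoSqrt.IsMAccretive (KatoSqrt.opMul (S ξ) (S ξ).adjoint.inverse) ∧
        (∀ h, (KatoSqrt.quad (KatoSqrt.opMul (S ξ) (S ξ).adjoint.inverse) h).re = 0) ∧
        (KatoSqrt.opMul (S ξ) (S ξ).adjoint.inverse).domain <
          (KatoSqrt.opMul (S ξ) (S ξ).adjoint.inverse).adjoint.domain) := by
  have hnt : Nontrivial H := by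
    by_contra hn
    rw [not_nontrivial_iff_subsingleton] at hn
    exact hH inferInstance
  obtain ⟨B, J₁, J₂, K, h, hcont, hran, hinj⟩ := KatoSqrt.exists_family hH
  have hT := KatoSqrt.continuous_rotated hcont
  choose a ha hadom using fun ξ => (h ξ).exists_isAssociated
  have hmem : ∀ ξ x, x ∈ KatoSqrt.imRange (KatoSqrt.rotated B (K ξ)) ↔
      ∃ z, B (J₁ z + ξ • J₂ z) = x := by
    intro ξ x
    rw [(h ξ).mem_imRange]
    simp_rw [hran]
    exact ⟨fun ⟨y, ⟨z, hz⟩, hy⟩ => ⟨z, by rw [hz, hy]⟩, fun ⟨z, hz⟩ => ⟨_, ⟨z, rfl⟩, hz⟩⟩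
  refine ⟨fun ξ => KatoSqrt.opInv (KatoSqrt.rotated B (K ξ) * KatoSqrt.rotated B (K ξ)),
    fun ξ => KatoSqrt.opInv (KatoSqrt.rotated B (K ξ)), fun ξ => KatoSqrt.rotated B (K ξ),
    KatoSqrt.normResolventContinuous_opInv (hT.mul hT) fun ξ => (h ξ).sq_injective,
    fun ξ => ⟨(h ξ).isMAccretive_opInv_sq, (h ξ).not_isSectorial_opInv_sq,
      (h ξ).not_isBounded_opInv_sq, _, KatoSqrt.isBoundedInverse_opInv (h ξ).sq_injective⟩,
    fun ξ => ⟨(h ξ).isMAccretiveSqrt, (h ξ).isMAccretiveSqrt_adjoint,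
      KatoSqrt.isBoundedInverse_opInv (h ξ).rotated_injective⟩,
    fun ξ => (h ξ).domain_inf_domain_adjoint, fun ξ => (h ξ).domain_ne_domain_adjoint,
    fun ξ ζ => Subtype.ext ((h ξ).realPart_rotated.trans (h ζ).realPart_rotated.symm),
    ⟨a, ha, fun ξ ζ => (hadom ξ).trans (hadom ζ).symm⟩, fun ξ => (h ξ).dense_imRange, ?_, ?_,
    fun ξ => ⟨(h ξ).isMAccretive_opMul_adjoint_inverse, (h ξ).re_quad_opMul_adjoint_inverse,
      (h ξ).domain_opMul_adjoint_inverse_lt⟩⟩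
  · intro ξ ζ hne
    rw [eq_bot_iff]
    rintro x ⟨hx1, hx2⟩
    obtain ⟨y, hy⟩ := (hmem ξ x).1 hx1
    obtain ⟨z, hz⟩ := (hmem ζ x).1 hx2
    obtain ⟨rfl, e⟩ := hinj _ _ _ _ ((h ξ).injective (hy.trans hz.symm))
    have e2 : (ξ - ζ) • y = 0 := by rw [sub_smul, e, sub_self]
    rw [smul_eq_zero_iff_right (sub_ne_zero.2 hne)] at e2
    rw [← hy, e2]
    simp
  -- The common sum is `B(ran J₁ + ran J₂)`: for `ξ ≠ ζ`, the vectors `(1, ξ)` and `(1, ζ)` span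
  -- `ℂ²`.
  · refine ⟨LinearMap.range ((B * J₁ : H →L[ℂ] H) : H →ₗ[ℂ] H) ⊔
      LinearMap.range ((B * J₂ : H →L[ℂ] H) : H →ₗ[ℂ] H), fun ξ ζ hne => le_antisymm ?_ ?_⟩
    · have hle : ∀ ξ, KatoSqrt.imRange (KatoSqrt.rotated B (K ξ)) ≤
          LinearMap.range ((B * J₁ : H →L[ℂ] H) : H →ₗ[ℂ] H) ⊔
            LinearMap.range ((B * J₂ : H →L[ℂ] H) : H →ₗ[ℂ] H) := by
        intro ξ x hx
        obtain ⟨z, rfl⟩ := (hmem ξ x).1 hx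
        rw [map_add, map_smul]
        exact Submodule.add_mem_sup ⟨z, rfl⟩ (Submodule.smul_mem _ _ ⟨z, rfl⟩)
      exact sup_le (hle ξ) (hle ζ)
    · have hne' : ξ - ζ ≠ 0 := sub_ne_zero.2 hne
      refine sup_le ?_ ?_
      · rintro _ ⟨x, rfl⟩
        -- The two witnesses solve `y + z = x`, `ξy + ζz = 0`.
        refine Submodule.mem_sup.2 ⟨B (J₁ (-(ζ / (ξ - ζ)) • x) + ξ • J₂ (-(ζ / (ξ - ζ)) • x)),
          (hmem ξ _).2 ⟨_, rfl⟩, B (J₁ ((ξ / (ξ - ζ)) • x) + ζ • J₂ ((ξ / (ξ - ζ)) • x)),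
          (hmem ζ _).2 ⟨_, rfl⟩, ?_⟩
        change _ = B (J₁ x)
        rw [← map_add]
        congr 1
        have e : ξ / (ξ - ζ) - ζ / (ξ - ζ) = 1 := by field_simp
        simp only [map_smul]
        linear_combination (norm := module) e • J₁ x
      · rintro _ ⟨x, rfl⟩
        -- Here the system is `y + z = 0`, `ξy + ζz = x`.
        refine Submodule.mem_sup.2 ⟨B (J₁ ((ξ - ζ)⁻¹ • x) + ξ • J₂ ((ξ - ζ)⁻¹ • x)),
          (hmem ξ _).2 ⟨_, rfl⟩, B (J₁ (-(ξ - ζ)⁻¹ • x) + ζ • J₂ (-(ξ - ζ)⁻¹ • x)),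
          (hmem ζ _).2 ⟨_, rfl⟩, ?_⟩
        change _ = B (J₂ x)
        rw [← map_add]
        congr 1
        have e : ξ * (ξ - ζ)⁻¹ - ζ * (ξ - ζ)⁻¹ = 1 := by field_simp
        simp only [map_smul]
        linear_combination (norm := module) e • J₂ x
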